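/- Let $n,m\in\mathbb N$, let $A:\mathbb R^n\rightrightarrows\mathbb R^n$ and $B:\mathbb R^m\rightrightarrows\mathbb R^m$ be set-valued operators and let $L\in\mathbb R^{m\times n}$ be a nonzero matrix with rank $r$, spectral norm $\|L\|$ and distinct strictly positive singular values $\|L\|=\sigma_1>\sigma_2>\dots>\sigma_d$. Write $[t]_+=\max\{0,t\}$, $[t]_-=\min\{0,t\}$, $\operatorname{zer}T=\{z : 0\in Tz\}$, $J_T=(\mathrm{id}+T)^{-1}$, let $P_E$ denote orthogonal projection onto a subspace $E$, and for $\gamma,\tau>0$ put $$T_{PD}(x,y)=\begin{bmatrix}Ax+L^\top y\\ B^{-1}y-Lx\end{bmatrix},\qquad M=\begin{bmatrix}\tfrac1\gamma I_n&-L^\top\\-L&\tfrac1\tau I_m\end{bmatrix}.$$ **Assumptions.** $A$ and $B$ are outer semicontinuous (i.e. have closed graphs), and $J_{\gamma A}$ and $J_{\tau B^{-1}}$ have full domain for the stepsizes $\gamma,\tau>0$ below. There are $\beta_P,\beta_P',\beta_D,\beta_D'\in\mathbb R$ and a nonempty set $S^\star\subseteq\operatorname{zer}T_{PD}$ with $$\langle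 v,z-z^\star\rangle\ge\langle v,Vv\rangle\quad\text{for all }z^\star\in S^\star,\ v\in T_{PD}z,$$ where $$V=\bigl(\beta_PP_{\operatorname{range}L^\top}+\beta_P'P_{\ker L}\bigr)\oplus\bigl(\beta_DP_{\operatorname{range}L}+\beta_D'P_{\ker L^\top}\bigr),$$ and $$[\beta_P]_-[\beta_D]_-<\tfrac1{4\|L\|^2},\quad[\beta_P']_-[\beta_D']_-<\tfrac1{\|L\|^2},\quad[-\beta_P']_+<\gamma_{\max},\quad[-\beta_D']_+<\tfrac1{\gamma_{\min}\|L\|^2},$$ with $\gamma_{\min},\gamma_{\max}$ defined next. **Stepsize Rule 1.** Let $\delta=1+[\beta_P\beta_D]_-(\|L\|^2-\sigma_d^2)$ and $$\gamma_{\min}=\frac{2[-\beta_P]_+}{\delta+\sqrt{\delta^2-4\beta_P\beta_D\|L\|^2}},\quad\gamma_{\max}=\frac{\delta+\sqrt{\delta^2-4\beta_P\beta_D\|L\|^2}}{2[-\beta_D]_+\|L\|^2},\quad\tau_{\min}(\gamma)=\frac{[-\beta_D]_+(\gamma+\beta_P)}{\gamma(\delta-\beta_P\beta_D\|L\|^2)+\beta_P},$$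 where $\gamma_{\min}=0$ if $\beta_P\ge0$, $\gamma_{\max}=+\infty$ and $\tau_{\min}(\gamma)=0$ if $\beta_D\ge0$, and in general $1/0=+\infty$ in the bounds. The stepsizes satisfy $$\gamma\in\Bigl(\max\{\gamma_{\min},[-\beta_P']_+\},\ \min\bigl\{\gamma_{\max},\tfrac1{[-\beta_D']_+\|L\|^2}\bigr\}\Bigr),\qquad\tau\in\Bigl(\max\{\tau_{\min}(\gamma),[-\beta_D']_+\},\ \tfrac1{\gamma\|L\|^2}\Bigr].$$ **Relaxation Rule 1.** Let $\theta(\sigma)=\sqrt{\bigl(\tfrac{\beta_P}{2\gamma}-\tfrac{\beta_D}{2\tau}\bigr)^2+\beta_P\beta_D\sigma^2}$, $\ \kappa(\sigma)=1+\tfrac{\beta_P}{2\gamma}+\tfrac{\beta_D}{2\tau}-\theta(\sigma)$, and define $\eta$ as follows. - If $\gamma\tau<1/\|L\|^2$: $\eta=\kappa(\sigma_d)$ if $\beta_P\beta_D<0$, and $\eta=\kappa(\|L\|)$ if $\beta_P\beta_D\ge0$. - If $\gamma\tau=1/\|L\|^2$ and $d=1$: $\eta=1+\tfrac{\beta_P}\gamma+\tfrac{\beta_D}\tau$.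 - If $\gamma\tau=1/\|L\|^2$ and $d>1$: $\eta=\kappa(\sigma_d)$ if $\beta_P\beta_D<0$; $\eta=\kappa(\sigma_2)$ if $\min\{\beta_P,\beta_D\}\ge0$; and $\eta=1+\tfrac{\beta_P}\gamma+\tfrac{\beta_D}\tau$ otherwise. Let $\eta'=+\infty$ if $r=m=n$; $\eta'=1+\tfrac{\beta_P'}\gamma$ if $r=m<n$; $\eta'=1+\tfrac{\beta_D'}\tau$ if $r=n<m$; and $\eta'=\min\{1+\tfrac{\beta_P'}\gamma,1+\tfrac{\beta_D'}\tau\}$ if $r<\min\{m,n\}$. Put $\bar\eta=\min\{\eta,\eta'\}$. The relaxation parameters satisfy $\lambda_k\in(0,2\bar\eta)$ for all $k$ and $\liminf_{k\to\infty}\lambda_k(2\bar\eta-\lambda_k)>0$. **Theorem.** Under these assumptions, let $z^k=(x^k,y^k)$ and $\bar z^k=(\bar x^k,\bar y^k)$, $k\in\mathbb N$, be generated from any $z^0\in\mathbb R^{n+m}$ by the Chambolle–Pock algorithm $$\bar x^k\in J_{\gamma A}(x^k-\gamma L^\top y^k),\quad\bar y^k\in J_{\tau B^{-1}}\bigl(y^k+\tau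 L(2\bar x^k-x^k)\bigr),\quad z^{k+1}=z^k+\lambda_k(\bar z^k-z^k).$$ Then either $\bar z^k\in\operatorname{zer}T_{PD}$ for some $k$, or all of the following hold: 1. $\bar v^k:=M(z^k-\bar z^k)\in T_{PD}\bar z^k$ for all $k$, and $\bar v^k\to0$. 2. Every limit point of $(\bar z^k)$ belongs to $\operatorname{zer}T_{PD}$. 3. The sequences $(P_{\operatorname{range}M}z^k)$ and $(P_{\operatorname{range}M}\bar z^k)$ are bounded. Moreover, if $J_{\gamma A}$ and $J_{\tau B^{-1}}$ are single-valued and continuous, then: 4. The limit points of $(P_{\operatorname{range}M}z^k)$ lie in $P_{\operatorname{range}M}\operatorname{zer}T_{PD}$. 5. If $S^\star=\operatorname{zer}T_{PD}$, then $(P_{\operatorname{range}M}z^k)$ converges to an element of $P_{\operatorname{range}M}\operatorname{zer}T_{PD}$ and $(\bar z^k)$ converges to an element of $\operatorname{zer}T_{PD}$. If in addition $\lambda_k$ is uniformly bounded in $(0,2)$, i.e. $\varepsilon\le\lambda_k\le2-\varepsilon$ for some $\varepsilon>0$ and all $k$, then $(z^k)$ converges to an element of $\operatorname{zer}T_{PD}$.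 -/

import Mathlib

open Filter Topology

namespace ChambollePock

noncomputable section

/-- Euclidean space of dimension `n`. -/
abbrev Rn (n : ℕ) : Type := EuclideanSpace ℝ (Fin n)

/-- The primal-dual space of pairs `z = (x, y)`, with its Euclidean inner product. -/
abbrev Rnm (n m : ℕ) : Type := WithLp 2 (Rn n × Rn m)

/-! ### Set-valued operators -/

section Operators

/-- The zeros of a set-valued operator. -/
def zer {X Y : Type*} [Zero Y] (T : X → Set Y) : Set X := {x | 0 ∈ T x}

/-- The domain of a set-valued operator. -/
def dom {X Y : Type*} (T : X → Set Y) : Set X := {x | (T x).Nonempty}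

/-- The inverse operator: `x ∈ T⁻¹ y` iff `y ∈ T x`. -/
def opInv {X Y : Type*} (T : X → Set Y) : Y → Set X := fun y => {x | y ∈ T x}

/-- The operator `c T`, i.e. `x ↦ {c v | v ∈ T x}`. -/
def opScale {X Y : Type*} [SMul ℝ Y] (c : ℝ) (T : X → Set Y) : X → Set Y :=
  fun x => {w | ∃ v ∈ T x, w = c • v}

/-- The resolvent `J_T = (id + T)⁻¹`: `x ∈ J_T u` iff `u ∈ x + T x`. -/
def opResolvent {X : Type*} [Add X] (T : X → Set X) : X → Set X :=
  opInv (fun x => {u | ∃ v ∈ T x, u = x + v})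

/-- Outer semicontinuity at every point: limits of points of the graph lie in the graph. -/
def OuterSemicontinuous {X Y : Type*} [TopologicalSpace X] [TopologicalSpace Y]
    (T : X → Set Y) : Prop :=
  ∀ (x : X) (y : Y) (u : ℕ → X) (v : ℕ → Y), (∀ k, v k ∈ T (u k)) →
    Tendsto u atTop (𝓝 x) → Tendsto v atTop (𝓝 y) → y ∈ T x

/-- The operator is (single-valued, everywhere defined and) continuous. -/
def SingleValuedContinuous {X Y : Type*} [TopologicalSpace X] [TopologicalSpace Y]
    (T : X → Set Y) : Prop :=
  ∃ f : X → Y, Continuous f ∧ ∀ x, T x = {f x}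

/-- `T` has `V`-oblique weak Minty solutions at the nonempty set `S ⊆ zer T`:
`⟪v, z - z⋆⟫ ≥ ⟪v, V v⟫` for all `z⋆ ∈ S` and all `(z, v)` in the graph of `T`. -/
def HasObliqueWeakMinty {H : Type*} [NormedAddCommGroup H] [InnerProductSpace ℝ H]
    (T : H → Set H) (V : H → H) (S : Set H) : Prop :=
  S.Nonempty ∧ S ⊆ zer T ∧
    ∀ zs ∈ S, ∀ z v : H, v ∈ T z → inner ℝ v (V v) ≤ inner ℝ v (z - zs)

end Operators

/-! ### The primal-dual operator, the preconditioner and the algorithm -/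

section PrimalDual

variable {n m : ℕ}

/-- The transpose of `L`. -/
abbrev trL (L : Rn n →L[ℝ] Rn m) : Rn m →L[ℝ] Rn n := ContinuousLinearMap.adjoint L

/-- The primal-dual operator `(x, y) ↦ (A x + Lᵀ y) × (B⁻¹ y - L x)`. -/
def TPD (A : Rn n → Set (Rn n)) (B : Rn m → Set (Rn m)) (L : Rn n →L[ℝ] Rn m) :
    Rnm n m → Set (Rnm n m) :=
  fun z => {w | ∃ a ∈ A z.fst, ∃ b ∈ opInv B z.snd,
    w = WithLp.toLp 2 (a + trL L z.snd, b - L z.fst)}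

/-- The preconditioner `P = [γ⁻¹ I, -Lᵀ; -L, τ⁻¹ I]`. -/
def precond (L : Rn n →L[ℝ] Rn m) (γ τ : ℝ) : Rnm n m →ₗ[ℝ] Rnm n m where
  toFun z := WithLp.toLp 2 ((1 / γ) • z.fst - trL L z.snd, -(L z.fst) + (1 / τ) • z.snd)
  map_add' z w := by
    apply WithLp.ofLp_injective
    simp only [WithLp.ofLp_add, WithLp.add_fst, WithLp.add_snd, map_add, smul_add, Prod.mk_add_mk,
      Prod.mk.injEq]
    constructor <;> abel
  map_smul' c z := by
    apply WithLp.ofLp_injective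
    simp only [WithLp.ofLp_smul, WithLp.smul_fst, WithLp.smul_snd, map_smul, RingHom.id_apply,
      Prod.smul_mk, Prod.mk.injEq, smul_sub, smul_add, smul_neg]
    constructor <;> simp only [smul_comm c]

/-- Orthogonal projection onto the range of the preconditioner. -/
def projRangeP (L : Rn n →L[ℝ] Rn m) (γ τ : ℝ) : Rnm n m → Rnm n m :=
  fun z => (LinearMap.range (precond L γ τ)).starProjection z

/-- The matrix `V = (βP P_{range Lᵀ} + βP' P_{ker L}) ⊕ (βD P_{range L} + βD' P_{ker Lᵀ})`,
as a map. -/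
def Vmap (L : Rn n →L[ℝ] Rn m) (βP βP' βD βD' : ℝ) : Rnm n m → Rnm n m :=
  fun z => WithLp.toLp 2
    (βP • (LinearMap.range (trL L).toLinearMap).starProjection z.fst
        + βP' • (LinearMap.ker L.toLinearMap).starProjection z.fst,
      βD • (LinearMap.range L.toLinearMap).starProjection z.snd
        + βD' • (LinearMap.ker (trL L).toLinearMap).starProjection z.snd)

/-- `z k = (x^k, y^k)` and `zb k = (x̄^k, ȳ^k)` are generated by the Chambolle–Pock algorithm with
stepsizes `γ, τ` and relaxation parameters `lam k`. -/
def IsCPSequence (A : Rn n → Set (Rn n)) (B : Rn m → Set (Rn m)) (L : Rn n →L[ℝ] Rn m)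
    (γ τ : ℝ) (lam : ℕ → ℝ) (z zb : ℕ → Rnm n m) : Prop :=
  ∀ k,
    (zb k).fst ∈ opResolvent (opScale γ A) ((z k).fst - γ • trL L (z k).snd) ∧
    (zb k).snd ∈ opResolvent (opScale τ (opInv B))
      ((z k).snd + τ • L ((2 : ℝ) • (zb k).fst - (z k).fst)) ∧
    (z (k + 1)).fst = (z k).fst + lam k • ((zb k).fst - (z k).fst) ∧
    (z (k + 1)).snd = (z k).snd + lam k • ((zb k).snd - (z k).snd)

end PrimalDual

/-! ### Singular values, stepsize rule and relaxation rule -/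

section Rules

variable {n m : ℕ}

/-- The set `{σ₁ > σ₂ > ⋯ > σ_d}` of distinct strictly positive singular values of `L`. -/
def posSingularValues (L : Rn n →L[ℝ] Rn m) : Set ℝ :=
  Set.range L.toLinearMap.singularValues ∩ Set.Ioi 0

/-- The number `d` of distinct strictly positive singular values. -/
def numSV (L : Rn n →L[ℝ] Rn m) : ℕ := (posSingularValues L).ncard

/-- The smallest strictly positive singular value `σ_d` (the set is finite, and it is nonempty for
`L ≠ 0`). -/
def sigmaLast (L : Rn n →L[ℝ] Rn m) : ℝ := sInf (posSingularValues L)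

/-- The second largest distinct singular value `σ₂` (meaningful, and used, only for `d > 1`). -/
def sigmaSecond (L : Rn n →L[ℝ] Rn m) : ℝ :=
  sSup {σ ∈ posSingularValues L | σ < sSup (posSingularValues L)}

/-- The rank of `L`. -/
def rankL (L : Rn n →L[ℝ] Rn m) : ℕ := Module.finrank ℝ (LinearMap.range L.toLinearMap)

/-- The positive part `[t]₊ = max {0, t}`. -/
def posP (t : ℝ) : ℝ := max 0 t

/-- The (nonpositive) negative part `[t]₋ = min {0, t}`. -/
def negP (t : ℝ) : ℝ := min 0 t

/-- The quotient `a / b` for `a > 0` and `b ≥ 0`, with `a / 0 = +∞`. -/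
def divTop (a b : ℝ) : EReal := if b = 0 then ⊤ else ((a / b : ℝ) : EReal)

/-- `δ = 1 + [βP βD]₋ (‖L‖² - σ_d²)`. -/
def delta (L : Rn n →L[ℝ] Rn m) (βP βD : ℝ) : ℝ :=
  1 + negP (βP * βD) * (‖L‖ ^ 2 - sigmaLast L ^ 2)

/-- `γ_min`. -/
def gammaMin (L : Rn n →L[ℝ] Rn m) (βP βD : ℝ) : ℝ :=
  2 * posP (-βP) / (delta L βP βD + √(delta L βP βD ^ 2 - 4 * βP * βD * ‖L‖ ^ 2))

/-- `γ_max`, which is `+∞` for `βD ≥ 0`. -/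
def gammaMax (L : Rn n →L[ℝ] Rn m) (βP βD : ℝ) : EReal :=
  divTop (delta L βP βD + √(delta L βP βD ^ 2 - 4 * βP * βD * ‖L‖ ^ 2))
    (2 * posP (-βD) * ‖L‖ ^ 2)

/-- `τ_min(γ)`, which is `0` for `βD ≥ 0`. -/
def tauMin (L : Rn n →L[ℝ] Rn m) (βP βD γ : ℝ) : ℝ :=
  posP (-βD) * (γ + βP) / (γ * (delta L βP βD - βP * βD * ‖L‖ ^ 2) + βP)

/-- The existence conditions on the parameters `βP, βP', βD, βD'`. -/
structure ExistenceConditions (L : Rn n →L[ℝ] Rn m) (βP βP' βD βD' : ℝ) : Prop where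
  range_cond : negP βP * negP βD < 1 / (4 * ‖L‖ ^ 2)
  ker_cond : negP βP' * negP βD' < 1 / ‖L‖ ^ 2
  gammaMax_cond : (posP (-βP') : EReal) < gammaMax L βP βD
  gammaMin_cond : (posP (-βD') : EReal) < divTop 1 (gammaMin L βP βD * ‖L‖ ^ 2)

/-- The stepsize rule. -/
structure StepsizeRule (L : Rn n →L[ℝ] Rn m) (βP βP' βD βD' γ τ : ℝ) : Prop where
  gamma_lower : max (gammaMin L βP βD) (posP (-βP')) < γ
  gamma_upper : (γ : EReal) < min (gammaMax L βP βD) (divTop 1 (posP (-βD') * ‖L‖ ^ 2))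
  tau_lower : max (tauMin L βP βD γ) (posP (-βD')) < τ
  tau_upper : τ ≤ 1 / (γ * ‖L‖ ^ 2)

/-- `θ_{γτ}(σ)`. -/
def theta (βP βD γ τ σ : ℝ) : ℝ :=
  √((1 / (2 * γ) * βP - 1 / (2 * τ) * βD) ^ 2 + βP * βD * σ ^ 2)

open Classical in
/-- The constant `η`, for stepsizes with `γ τ ≤ 1 / ‖L‖²`. -/
def eta (L : Rn n →L[ℝ] Rn m) (βP βD γ τ : ℝ) : ℝ :=
  if γ * τ < 1 / ‖L‖ ^ 2 then
    if βP * βD < 0 then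
      1 + 1 / (2 * γ) * βP + 1 / (2 * τ) * βD - theta βP βD γ τ (sigmaLast L)
    else
      1 + 1 / (2 * γ) * βP + 1 / (2 * τ) * βD - theta βP βD γ τ ‖L‖
  else if numSV L = 1 then
    1 + 1 / γ * βP + 1 / τ * βD
  else
    if βP * βD < 0 then
      1 + 1 / (2 * γ) * βP + 1 / (2 * τ) * βD - theta βP βD γ τ (sigmaLast L)
    else if 0 ≤ min βP βD then
      1 + 1 / (2 * γ) * βP + 1 / (2 * τ) * βD - theta βP βD γ τ (sigmaSecond L)
    else
      1 + 1 / γ * βP + 1 / τ * βD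

/-- The constant `η'`. -/
def etaPrime (L : Rn n →L[ℝ] Rn m) (βP' βD' γ τ : ℝ) : EReal :=
  if rankL L = m then
    if rankL L = n then ⊤ else ((1 + 1 / γ * βP' : ℝ) : EReal)
  else
    if rankL L = n then ((1 + 1 / τ * βD' : ℝ) : EReal)
    else ((min (1 + 1 / γ * βP') (1 + 1 / τ * βD') : ℝ) : EReal)

/-- `η̄ = min {η, η'}`; this is a real number since `η` is real and `η' > -∞`. -/
def etaBar (L : Rn n →L[ℝ] Rn m) (βP βP' βD βD' γ τ : ℝ) : ℝ :=
  (min (eta L βP βD γ τ : EReal) (etaPrime L βP' βD' γ τ)).toReal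

/-- The relaxation rule: `lam k ∈ (0, 2 η̄)` and `liminf lam k (2 η̄ - lam k) > 0`. -/
structure RelaxationRule (L : Rn n →L[ℝ] Rn m) (βP βP' βD βD' γ τ : ℝ) (lam : ℕ → ℝ) :
    Prop where
  mem : ∀ k, lam k ∈ Set.Ioo 0 (2 * etaBar L βP βP' βD βD' γ τ)
  liminf_pos :
    0 < liminf (fun k => lam k * (2 * etaBar L βP βP' βD βD' γ τ - lam k)) atTop

end Rules

end

end ChambollePock

open ChambollePock

/-! The iteration is a relaxed preconditioned proximal point method. With `u = z k - zb k`, the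
resolvent inclusions say that `M u` lies in `TPD (zb k)`, so the weak Minty inequality gives `⟪M u,
z k - q⟫ ≥ ⟪M u, u⟫ + ⟪M u, V M u⟫` for every `q ∈ S`. The crux is the operator inequality `M + M V
M ≥ η̄ M` (`etaBar_mul_inner_le`). Both `M` and `V` commute with `K = LᵀL ⊕ LLᵀ`, so it suffices to
test eigenvectors of `K`. Eigenvalue `0` produces the constants in `η'`. An eigenvalue `σ² > 0`
leaves a binary form in the components of `M u`, controlled by `κ(σ)` when `γτσ² < 1` and by a
scalar identity when `γτσ² = 1` (`block_form_nonneg`). `eta_le` compares `η` with all these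
constants.

The inequality makes the iterates Fejér monotone in the seminorm of `M`, with decrease `lam k * (2
η̄ - lam k) * ⟪M u, u⟫`. Hence `M u → 0` and `M (z k)` is bounded, and closed graphs turn limit
points of `zb` into zeros. Since `M` may be singular, nothing is known about `z k` along `ker M`.
With continuous resolvents, however, `zb k` is a continuous function of `M (z k)` alone
(`exists_eq_comp_precond`), so convergence of `M (z k)` carries over to `zb`, and to `z` when the
relaxation is bounded inside `(0, 2)`. -/

/-- A linear map commuting with a symmetric map is positive as soon as its quadratic form is
nonnegative on the eigenvectors of the symmetric map. -/
theorem inner_map_self_nonneg_of_commute {E : Type*} [NormedAddCommGroup E]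
    [InnerProductSpace ℝ E] [FiniteDimensional ℝ E] {K Q : E →ₗ[ℝ] E} (hK : K.IsSymmetric)
    (hc : ∀ u, Q (K u) = K (Q u)) (h : ∀ (μ : ℝ) (u : E), K u = μ • u → 0 ≤ inner ℝ (Q u) u)
    (u : E) : 0 ≤ inner ℝ (Q u) u := by
  have htop : (⨆ μ : ℝ, Module.End.eigenspace K μ) = ⊤ := by
    rw [← Submodule.orthogonal_eq_bot_iff]
    exact hK.orthogonalComplement_iSup_eigenspaces_eq_bot
  have hu : u ∈ ⨆ μ : ℝ, Module.End.eigenspace K μ := by rw [htop]; trivial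
  obtain ⟨f, hf, rfl⟩ := (Submodule.mem_iSup_iff_exists_finsupp _ _).1 hu
  have hf' : ∀ μ, K (f μ) = μ • f μ := fun μ => Module.End.mem_eigenspace_iff.1 (hf μ)
  -- Commutation makes `Q` preserve each eigenspace of `K`, and distinct eigenspaces are orthogonal.
  -- The cross terms of the quadratic form therefore vanish, with no symmetry of `Q` needed.
  have horth : ∀ μ ν, μ ≠ ν → inner ℝ (Q (f μ)) (f ν) = (0 : ℝ) := by
    intro μ ν hne
    have h1 : inner ℝ (K (Q (f μ))) (f ν) = inner ℝ (Q (f μ)) (K (f ν)) := hK _ _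
    rw [← hc, hf', hf', map_smul, inner_smul_left, inner_smul_right] at h1
    have h2 : (μ - ν) * inner ℝ (Q (f μ)) (f ν) = (0 : ℝ) := by
      simp at h1
      rcases h1 with h1 | h1
      · simp [h1]
      · simp [h1]
    exact (mul_eq_zero.1 h2).resolve_left (sub_ne_zero.2 hne)
  rw [Finsupp.sum, map_sum, sum_inner]
  refine Finset.sum_nonneg fun μ hμ => ?_
  rw [inner_sum, Finset.sum_eq_single μ (fun ν _ hne => horth μ ν hne.symm)
    (fun hn => absurd hμ hn)]
  exact h μ _ (hf' μ)

/-! ### Adjoints and projections onto the four fundamental subspaces -/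

namespace ChambollePock

variable {n m : ℕ}

theorem trL_trL (L : Rn n →L[ℝ] Rn m) : trL (trL L) = L :=
  ContinuousLinearMap.adjoint_adjoint L

theorem inner_trL_left (L : Rn n →L[ℝ] Rn m) (x : Rn n) (y : Rn m) :
    inner ℝ (trL L y) x = inner ℝ y (L x) :=
  ContinuousLinearMap.adjoint_inner_left L x y

theorem inner_trL_right (L : Rn n →L[ℝ] Rn m) (x : Rn n) (y : Rn m) :
    inner ℝ x (trL L y) = inner ℝ (L x) y :=
  ContinuousLinearMap.adjoint_inner_right L x y

theorem ker_eq_range_trL_orthogonal (L : Rn n →L[ℝ] Rn m) :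
    LinearMap.ker L.toLinearMap = (LinearMap.range (trL L).toLinearMap)ᗮ := by
  ext x
  rw [Submodule.mem_orthogonal]
  constructor
  · rintro hx _ ⟨y, rfl⟩
    have : L x = 0 := hx
    simp [inner_trL_left, this]
  · intro h
    have := h (trL L (L x)) ⟨_, rfl⟩
    rw [inner_trL_left, inner_self_eq_zero] at this
    exact this

theorem starProjection_range_trL_apply (L : Rn n →L[ℝ] Rn m) (y : Rn m) :
    (LinearMap.range (trL L).toLinearMap).starProjection (trL L y) = trL L y :=
  Submodule.starProjection_eq_self_iff.2 ⟨y, rfl⟩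

theorem starProjection_ker_trL_apply (L : Rn n →L[ℝ] Rn m) (y : Rn m) :
    (LinearMap.ker L.toLinearMap).starProjection (trL L y) = 0 := by
  rw [Submodule.starProjection_apply_eq_zero_iff, ker_eq_range_trL_orthogonal,
    Submodule.orthogonal_orthogonal]
  exact ⟨y, rfl⟩

theorem map_starProjection_ker (L : Rn n →L[ℝ] Rn m) (x : Rn n) :
    L ((LinearMap.ker L.toLinearMap).starProjection x) = 0 :=
  Submodule.starProjection_apply_mem (LinearMap.ker L.toLinearMap) x

theorem starProjection_range_trL_eq_zero (L : Rn n →L[ℝ] Rn m) {x : Rn n} (hx : L x = 0) :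
    (LinearMap.range (trL L).toLinearMap).starProjection x = 0 := by
  rw [Submodule.starProjection_apply_eq_zero_iff, ← ker_eq_range_trL_orthogonal]
  exact hx

theorem starProjection_ker_eq_self (L : Rn n →L[ℝ] Rn m) {x : Rn n} (hx : L x = 0) :
    (LinearMap.ker L.toLinearMap).starProjection x = x :=
  Submodule.starProjection_eq_self_iff.2 hx

theorem map_starProjection_range_trL (L : Rn n →L[ℝ] Rn m) (x : Rn n) :
    L ((LinearMap.range (trL L).toLinearMap).starProjection x) = L x := by
  have h : x - (LinearMap.range (trL L).toLinearMap).starProjection x ∈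
      LinearMap.ker L.toLinearMap := by
    rw [ker_eq_range_trL_orthogonal]
    exact Submodule.sub_starProjection_mem_orthogonal x
  have h' : L (x - (LinearMap.range (trL L).toLinearMap).starProjection x) = 0 := h
  rw [map_sub, sub_eq_zero] at h'
  exact h'.symm

/-- The linear map underlying `Vmap`, on one factor. -/
noncomputable def blockV (L : Rn n →L[ℝ] Rn m) (b b' : ℝ) : Rn n →L[ℝ] Rn n :=
  b • (LinearMap.range (trL L).toLinearMap).starProjection
    + b' • (LinearMap.ker L.toLinearMap).starProjection

theorem blockV_trL (L : Rn n →L[ℝ] Rn m) (b b' : ℝ) (y : Rn m) :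
    blockV L b b' (trL L y) = b • trL L y := by
  simp [blockV, starProjection_range_trL_apply, starProjection_ker_trL_apply]

theorem map_blockV (L : Rn n →L[ℝ] Rn m) (b b' : ℝ) (x : Rn n) :
    L (blockV L b b' x) = b • L x := by
  simp [blockV, map_starProjection_range_trL, map_starProjection_ker]

theorem blockV_of_map_eq_zero (L : Rn n →L[ℝ] Rn m) (b b' : ℝ) {x : Rn n} (hx : L x = 0) :
    blockV L b b' x = b' • x := by
  simp [blockV, starProjection_range_trL_eq_zero L hx, starProjection_ker_eq_self L hx]

theorem Vmap_eq (L : Rn n →L[ℝ] Rn m) (βP βP' βD βD' : ℝ) (z : Rnm n m) :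
    Vmap L βP βP' βD βD' z
      = WithLp.toLp 2 (blockV L βP βP' z.fst, blockV (trL L) βD βD' z.snd) := by
  simp [Vmap, blockV]

/-! ### Singular values -/

theorem finite_posSingularValues (L : Rn n →L[ℝ] Rn m) : (posSingularValues L).Finite :=
  (Finsupp.finite_range _).inter_of_left _

theorem adjoint_toLinearMap_comp_apply (L : Rn n →L[ℝ] Rn m) (x : Rn n) :
    (LinearMap.adjoint L.toLinearMap ∘ₗ L.toLinearMap) x = trL L (L x) := by
  refine ext_inner_right ℝ fun v => ?_
  rw [inner_trL_left]
  simp [LinearMap.adjoint_inner_left]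

theorem sqrt_mem_posSingularValues (L : Rn n →L[ℝ] Rn m) {s : ℝ} (hs : 0 < s) {x : Rn n}
    (hx : x ≠ 0) (h : trL L (L x) = s • x) : √s ∈ posSingularValues L := by
  have hev : Module.End.HasEigenvalue
      (LinearMap.adjoint L.toLinearMap ∘ₗ L.toLinearMap) s := by
    refine Module.End.hasEigenvalue_of_hasEigenvector (x := x) ⟨?_, hx⟩
    rw [Module.End.mem_eigenspace_iff, adjoint_toLinearMap_comp_apply, h]
  obtain ⟨i, hi⟩ := L.toLinearMap.isSymmetric_adjoint_comp_self.exists_eigenvalues_eq rfl hev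
  refine ⟨⟨i, ?_⟩, Real.sqrt_pos.2 hs⟩
  rw [LinearMap.singularValues_fin _ rfl]
  congr 1

/-- `LᵀL` and `LLᵀ` share their nonzero eigenvalues: `Lᵀ y` is an eigenvector of the former, and it
is nonzero because `s • y ≠ 0`. -/
theorem sqrt_mem_posSingularValues' (L : Rn n →L[ℝ] Rn m) {s : ℝ} (hs : 0 < s) {y : Rn m}
    (hy : y ≠ 0) (h : L (trL L y) = s • y) : √s ∈ posSingularValues L := by
  refine sqrt_mem_posSingularValues L hs (x := trL L y) ?_ (by rw [h, map_smul])
  intro h0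
  rw [h0, map_zero] at h
  exact smul_ne_zero hs.ne' hy h.symm

theorem norm_sq_map_eq (L : Rn n →L[ℝ] Rn m) {s : ℝ} {x : Rn n}
    (h : trL L (L x) = s • x) : ‖L x‖ ^ 2 = s * ‖x‖ ^ 2 := by
  rw [← real_inner_self_eq_norm_sq, ← inner_trL_left, h, real_inner_smul_left,
    real_inner_self_eq_norm_sq]

theorem eigenvalue_nonneg (L : Rn n →L[ℝ] Rn m) {s : ℝ} {x : Rn n} (hx : x ≠ 0)
    (h : trL L (L x) = s • x) : 0 ≤ s := by
  have h1 := norm_sq_map_eq L h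
  have h2 : 0 < ‖x‖ ^ 2 := by positivity
  by_contra! hs
  nlinarith [sq_nonneg ‖L x‖]

theorem eq_singularValue_eigenvector (L : Rn n →L[ℝ] Rn m) {σ : ℝ}
    (hσ : σ ∈ posSingularValues L) : ∃ x : Rn n, x ≠ 0 ∧ trL L (L x) = σ ^ 2 • x := by
  obtain ⟨⟨i, rfl⟩, hpos⟩ := hσ
  have hi : i < Module.finrank ℝ (Rn n) := by
    by_contra! hle
    have := L.toLinearMap.singularValues_of_finrank_le hle
    rw [this] at hpos
    exact lt_irrefl (0 : ℝ) hpos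
  obtain ⟨x, hx⟩ :=
    (L.toLinearMap.hasEigenvalue_adjoint_comp_self_sq_singularValues hi).exists_hasEigenvector
  refine ⟨x, hx.2, ?_⟩
  have := Module.End.mem_eigenspace_iff.1 hx.1
  rw [adjoint_toLinearMap_comp_apply] at this
  exact this

theorem posSingularValues_le_norm (L : Rn n →L[ℝ] Rn m) {σ : ℝ}
    (hσ : σ ∈ posSingularValues L) : σ ≤ ‖L‖ := by
  obtain ⟨x, hx, h⟩ := eq_singularValue_eigenvector L hσ
  have h1 := norm_sq_map_eq L h
  have h2 : ‖L x‖ ≤ ‖L‖ * ‖x‖ := L.le_opNorm x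
  have h3 : 0 < ‖x‖ := norm_pos_iff.2 hx
  have h4 : (0 : ℝ) < σ := hσ.2
  rw [← mul_pow] at h1
  have h5 : ‖L x‖ = σ * ‖x‖ := by
    rwa [pow_left_inj₀ (norm_nonneg _) (by positivity) two_ne_zero] at h1
  rw [h5] at h2
  exact le_of_mul_le_mul_right h2 h3

/-- `c² I - LᵀL` commutes with `LᵀL`, so its positivity need only be checked on eigenvectors of
`LᵀL`. -/
theorem norm_le_of_posSingularValues_le (L : Rn n →L[ℝ] Rn m) {c : ℝ} (hc : 0 ≤ c)
    (h : ∀ σ ∈ posSingularValues L, σ ≤ c) : ‖L‖ ≤ c := by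
  refine L.opNorm_le_bound hc fun x => ?_
  let K : Rn n →ₗ[ℝ] Rn n := (trL L ∘L L).toLinearMap
  let Q : Rn n →ₗ[ℝ] Rn n := c ^ 2 • LinearMap.id - K
  have hK : K.IsSymmetric := fun u v => by
    change inner ℝ (trL L (L u)) v = inner ℝ u (trL L (L v))
    rw [inner_trL_left, inner_trL_right]
  have hQ : ∀ u, inner ℝ (Q u) u = c ^ 2 * ‖u‖ ^ 2 - ‖L u‖ ^ 2 := by
    intro u
    change inner ℝ (c ^ 2 • u - trL L (L u)) u = _
    rw [inner_sub_left, inner_trL_left, real_inner_smul_left, real_inner_self_eq_norm_sq,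
      real_inner_self_eq_norm_sq]
  have key : 0 ≤ inner ℝ (Q x) x := by
    refine inner_map_self_nonneg_of_commute hK (fun u => ?_) (fun μ u hu => ?_) x
    · simp [Q]
    · rw [hQ]
      rcases eq_or_ne u 0 with rfl | hu0
      · simp
      have hu' : trL L (L u) = μ • u := hu
      rw [norm_sq_map_eq L hu', ← sub_mul]
      refine mul_nonneg (sub_nonneg.2 ?_) (sq_nonneg _)
      rcases (eigenvalue_nonneg L hu0 hu').eq_or_lt with h0 | h0
      · rw [← h0]; positivity
      · have := h _ (sqrt_mem_posSingularValues L h0 hu0 hu')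
        exact (Real.sqrt_le_left hc).1 this
  rw [hQ, sub_nonneg, ← mul_pow] at key
  exact (pow_le_pow_iff_left₀ (norm_nonneg _) (by positivity) two_ne_zero).1 key

/-- The finite set of positive singular values has a maximum, which bounds `‖L‖` from both sides.
The set is nonempty, since otherwise the bound with `c = 0` would force `L = 0`. -/
theorem norm_mem_posSingularValues (L : Rn n →L[ℝ] Rn m) (hL : L ≠ 0) :
    ‖L‖ ∈ posSingularValues L := by
  have hne : (posSingularValues L).Nonempty := by
    by_contra! hemp
    have : ‖L‖ ≤ 0 := norm_le_of_posSingularValues_le L le_rfl (by simp [hemp])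
    exact hL (norm_le_zero_iff.1 this)
  have hfin := finite_posSingularValues L
  have hmem := hne.csSup_mem hfin
  have h1 := posSingularValues_le_norm L hmem
  have h2 := norm_le_of_posSingularValues_le L (le_of_lt hmem.2)
    (fun σ hσ => le_csSup hfin.bddAbove hσ)
  rwa [le_antisymm h1 h2] at hmem

end ChambollePock

namespace ChambollePock

variable {n m : ℕ}

/-! ### The two-by-two blocks -/

/-- Writing the form as `P X + Q Y + 2 t C` with `C² ≤ ρ P Q`, nonnegativity follows from `X, Y ≥ 0`
and `X Y ≥ t² ρ`. The latter holds because `X Y - t² ρ = (1 - ρ) ((t + α + δ)² - θ²)`, where `θ` is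
the square root in the hypothesis. -/
theorem binary_form_nonneg {α δ ρ t P Q C : ℝ} (hρ : 0 ≤ ρ) (hρ1 : ρ ≤ 1) (hP : 0 ≤ P)
    (hQ : 0 ≤ Q) (hC : C ^ 2 ≤ ρ * (P * Q)) (ht : √((α - δ) ^ 2 + 4 * α * δ * ρ) ≤ t + α + δ) :
    0 ≤ P * (t + 2 * α * (1 - ρ)) + Q * (t + 2 * δ * (1 - ρ)) + 2 * t * C := by
  set θ := √((α - δ) ^ 2 + 4 * α * δ * ρ) with hθ
  have hρ' : 0 ≤ 1 - ρ := by linarith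
  have hθ2 : θ ^ 2 = (α - δ) ^ 2 + 4 * α * δ * ρ := by
    apply Real.sq_sqrt
    have : (α - δ) ^ 2 + 4 * α * δ * ρ = (1 - ρ) * (α - δ) ^ 2 + ρ * (α + δ) ^ 2 := by ring
    rw [this]
    positivity
  have hθ0 : 0 ≤ θ := Real.sqrt_nonneg _
  -- The gap is `θ² - (δ - α + 2αρ)² = 4 α² ρ (1 - ρ)`; this yields `X ≥ 0`, and the symmetric bound
  -- yields `Y ≥ 0`.
  have hα : |δ - α + 2 * α * ρ| ≤ θ := by
    apply abs_le_of_sq_le_sq _ hθ0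
    rw [hθ2]
    nlinarith [mul_nonneg (mul_nonneg hρ hρ') (sq_nonneg α)]
  have hδ : |α - δ + 2 * δ * ρ| ≤ θ := by
    apply abs_le_of_sq_le_sq _ hθ0
    rw [hθ2]
    nlinarith [mul_nonneg (mul_nonneg hρ hρ') (sq_nonneg δ)]
  have hX : 0 ≤ t + 2 * α * (1 - ρ) := by linarith [le_of_abs_le hα]
  have hY : 0 ≤ t + 2 * δ * (1 - ρ) := by linarith [le_of_abs_le hδ]
  have hXY : t ^ 2 * ρ ≤ (t + 2 * α * (1 - ρ)) * (t + 2 * δ * (1 - ρ)) := by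
    have h1 : θ ^ 2 ≤ (t + α + δ) ^ 2 := pow_le_pow_left₀ hθ0 ht 2
    have h2 := mul_nonneg hρ' (sub_nonneg.2 h1)
    rw [hθ2] at h2
    linarith
  generalize t + 2 * α * (1 - ρ) = X at *
  generalize t + 2 * δ * (1 - ρ) = Y at *
  have hPQ : 0 ≤ P * Q := mul_nonneg hP hQ
  have hsq : (2 * t * C) ^ 2 ≤ (P * X + Q * Y) ^ 2 := by
    have h1 : t ^ 2 * C ^ 2 ≤ t ^ 2 * (ρ * (P * Q)) := mul_le_mul_of_nonneg_left hC (sq_nonneg t)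
    have h2 : t ^ 2 * ρ * (P * Q) ≤ X * Y * (P * Q) := mul_le_mul_of_nonneg_right hXY hPQ
    nlinarith [sq_nonneg (P * X - Q * Y)]
  have := neg_le_of_abs_le (abs_le_of_sq_le_sq hsq (by positivity))
  linarith

/-- Rescaling `P` by `1 / τ` and `Q` by `1 / γ` turns this into the binary form with `ρ = γτs` and
`t = 1 - η`; its square root is then exactly `theta` at `√s`. -/
theorem weighted_form_nonneg {γ τ s βP βD η P Q C : ℝ} (hγ : 0 < γ) (hτ : 0 < τ) (hs : 0 < s)
    (hlt : γ * τ * s < 1) (hP : 0 ≤ P) (hQ : 0 ≤ Q) (hC : C ^ 2 ≤ s * (P * Q))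
    (hη : η ≤ 1 + 1 / (2 * γ) * βP + 1 / (2 * τ) * βD - theta βP βD γ τ √s) :
    0 ≤ (1 - η) * (P / τ + 2 * C + Q / γ) + (1 / (γ * τ) - s) * (βP * P + βD * Q) := by
  have h := binary_form_nonneg (α := 1 / (2 * γ) * βP) (δ := 1 / (2 * τ) * βD) (ρ := γ * τ * s)
    (t := 1 - η) (P := P / τ) (Q := Q / γ) (C := C) (by positivity) hlt.le (by positivity)
    (by positivity) (hC.trans_eq (by field_simp)) ?_
  · convert h using 1
    field_simp
    ring
  · have : theta βP βD γ τ √s = √((1 / (2 * γ) * βP - 1 / (2 * τ) * βD) ^ 2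
        + 4 * (1 / (2 * γ) * βP) * (1 / (2 * τ) * βD) * (γ * τ * s)) := by
      rw [theta, Real.sq_sqrt hs.le]
      congr 2
      field_simp
      ring
    rw [← this]
    linarith

/-- The quadratic form of `(1 - η) M + M V M` on a singular subspace of `L`. -/
theorem block_form_nonneg (L : Rn n →L[ℝ] Rn m) {γ τ s βP βD η : ℝ} (hγ : 0 < γ) (hτ : 0 < τ)
    (hs : 0 < s) {x : Rn n} {y : Rn m} (hx : trL L (L x) = s • x) (hy : L (trL L y) = s • y)
    (hη : (γ * τ * s < 1 ∧
        η ≤ 1 + 1 / (2 * γ) * βP + 1 / (2 * τ) * βD - theta βP βD γ τ √s) ∨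
      (γ * τ * s = 1 ∧ η ≤ 1 + 1 / γ * βP + 1 / τ * βD)) :
    0 ≤ (1 - η) * (inner ℝ ((1 / γ) • x - trL L y) x + inner ℝ (-(L x) + (1 / τ) • y) y)
      + βP * ‖(1 / γ) • x - trL L y‖ ^ 2 + βD * ‖-(L x) + (1 / τ) • y‖ ^ 2 := by
  have hLx := norm_sq_map_eq L hx
  have hLy : ‖trL L y‖ ^ 2 = s * ‖y‖ ^ 2 := by
    apply norm_sq_map_eq (trL L)
    rw [trL_trL, hy]
  set p := (1 / γ) • x - trL L y with hp
  set q := -(L x) + (1 / τ) • y with hq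
  set a := ‖x‖ ^ 2 with ha
  set b := ‖y‖ ^ 2 with hb
  set c : ℝ := inner ℝ (L x) y with hc
  have hP : ‖p‖ ^ 2 = a / γ ^ 2 - 2 * c / γ + s * b := by
    rw [hp, norm_sub_sq_real, norm_smul, mul_pow, real_inner_smul_left, inner_trL_right, hLy,
      Real.norm_eq_abs, sq_abs, ← ha, ← hc]
    field_simp
  have hQ : ‖q‖ ^ 2 = b / τ ^ 2 - 2 * c / τ + s * a := by
    rw [hq, norm_add_sq_real, norm_smul, mul_pow, real_inner_smul_right, inner_neg_left, norm_neg,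
      hLx, Real.norm_eq_abs, sq_abs]
    field_simp
    ring
  have hpx : inner ℝ p x = a / γ - c := by
    rw [hp, inner_sub_left, real_inner_smul_left, inner_trL_left, real_inner_self_eq_norm_sq,
      real_inner_comm, ← ha, ← hc]
    ring
  have hqy : inner ℝ q y = b / τ - c := by
    rw [hq, inner_add_left, real_inner_smul_left, inner_neg_left, real_inner_self_eq_norm_sq,
      ← hb, ← hc]
    ring
  have hLp : L p = (1 / γ) • L x - s • y := by rw [hp, map_sub, map_smul, hy]
  have hpp : trL L (L p) = s • p := by
    rw [hLp, map_sub, map_smul, map_smul, hx, hp, smul_sub, smul_comm]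
  have hC : inner ℝ (L p) q = c / (γ * τ) - s * a / γ - s * b / τ + s * c := by
    rw [hLp, hq, inner_sub_left, inner_add_right, inner_add_right, inner_neg_right,
      inner_neg_right]
    simp only [real_inner_smul_left, real_inner_smul_right, real_inner_self_eq_norm_sq]
    rw [hLx, real_inner_comm (L x) y, ← hb, ← hc]
    field_simp
    ring
  -- Cauchy–Schwarz, with `‖L p‖² = s ‖p‖²` because `p` inherits the eigenvector equation from `x`
  -- and `y`.
  have hCS : (inner ℝ (L p) q) ^ 2 ≤ s * (‖p‖ ^ 2 * ‖q‖ ^ 2) := by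
    rw [← mul_assoc, ← norm_sq_map_eq L hpp, ← mul_pow]
    exact sq_le_sq' (neg_le_of_abs_le (abs_real_inner_le_norm _ _)) (real_inner_le_norm _ _)
  rcases hη with ⟨hlt, hη⟩ | ⟨heq, hη⟩
  -- Here `M` is invertible on the block, with determinant `1 / (γτ) - s`. Multiplying by it
  -- expresses `⟪M u, u⟫` through the components `p`, `q` of `M u`.
  · have hD : 0 < 1 / (γ * τ) - s := by
      rw [sub_pos, lt_div_iff₀ (by positivity)]
      linarith
    have h := weighted_form_nonneg hγ hτ hs hlt (sq_nonneg ‖p‖) (sq_nonneg ‖q‖) hCS hη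
    refine nonneg_of_mul_nonneg_right (h.trans_eq ?_) hD
    rw [hC, hpx, hqy, hP, hQ]
    field_simp
    ring
  -- Here the block is degenerate: `‖p‖²` and `‖q‖²` are fixed multiples of `⟪M u, u⟫`, so the whole
  -- form is a scalar times it.
  · have hs' : s = 1 / (γ * τ) := by
      field_simp
      linarith
    have hM : ‖p‖ ^ 2 = (1 / γ) * (inner ℝ p x + inner ℝ q y) := by
      rw [hP, hpx, hqy, hs']
      field_simp
      ring
    have hM' : ‖q‖ ^ 2 = (1 / τ) * (inner ℝ p x + inner ℝ q y) := by
      rw [hQ, hpx, hqy, hs']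
      field_simp
      ring
    have h0 : 0 ≤ inner ℝ p x + inner ℝ q y := by
      have : inner ℝ p x + inner ℝ q y = γ * ‖p‖ ^ 2 := by
        rw [hM]
        field_simp
      rw [this]
      positivity
    rw [hM, hM']
    have := mul_nonneg (sub_nonneg.2 hη) h0
    linarith

/-! ### The relaxation bound on the singular values -/

theorem theta_le_theta_of_nonneg {βP βD γ τ σ σ' : ℝ} (h : 0 ≤ βP * βD) (hσ : 0 ≤ σ)
    (hσσ' : σ ≤ σ') : theta βP βD γ τ σ ≤ theta βP βD γ τ σ' := by
  unfold theta
  gcongr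

theorem theta_le_theta_of_neg {βP βD γ τ σ σ' : ℝ} (h : βP * βD < 0) (hσ : 0 ≤ σ)
    (hσσ' : σ ≤ σ') : theta βP βD γ τ σ' ≤ theta βP βD γ τ σ := by
  unfold theta
  apply Real.sqrt_le_sqrt
  have : σ ^ 2 ≤ σ' ^ 2 := pow_le_pow_left₀ hσ hσσ' 2
  nlinarith

/-- At the critical value `σ² = 1 / (γτ)` the radicand becomes a perfect square. This links `κ(‖L‖)`
to the constant of the degenerate block. -/
theorem theta_eq_abs {βP βD γ τ σ : ℝ} (hγ : 0 < γ) (hτ : 0 < τ) (h : γ * τ * σ ^ 2 = 1) :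
    theta βP βD γ τ σ = |1 / (2 * γ) * βP + 1 / (2 * τ) * βD| := by
  rw [theta, ← Real.sqrt_sq_eq_abs]
  congr 1
  have : σ ^ 2 = 1 / (γ * τ) := by
    field_simp
    linarith
  rw [this]
  field_simp
  ring

/-- On every singular value, `η` is at most the corresponding block constant. -/
theorem eta_le (L : Rn n →L[ℝ] Rn m) (hL : L ≠ 0) {βP βD γ τ σ : ℝ} (hγ : 0 < γ) (hτ : 0 < τ)
    (hle : γ * τ ≤ 1 / ‖L‖ ^ 2) (hσ : σ ∈ posSingularValues L) :
    (γ * τ * σ ^ 2 < 1 ∧ eta L βP βD γ τ ≤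
        1 + 1 / (2 * γ) * βP + 1 / (2 * τ) * βD - theta βP βD γ τ σ) ∨
      (γ * τ * σ ^ 2 = 1 ∧ eta L βP βD γ τ ≤ 1 + 1 / γ * βP + 1 / τ * βD) := by
  have hnorm := norm_mem_posSingularValues L hL
  have hN : 0 < ‖L‖ := hnorm.2
  have hσ0 : 0 < σ := hσ.2
  have hσN := posSingularValues_le_norm L hσ
  have hfin := finite_posSingularValues L
  have hlast : sigmaLast L ≤ σ := csInf_le hfin.bddBelow hσ
  have hlast0 : 0 ≤ sigmaLast L := Real.sInf_nonneg fun x hx => le_of_lt hx.2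
  have hhalf : ∀ t β : ℝ, 1 / t * β = 2 * (1 / (2 * t) * β) := by
    intro t β
    rw [one_div, one_div, mul_inv]
    ring
  have hlt_of : σ < ‖L‖ → γ * τ * σ ^ 2 < 1 := by
    intro h
    calc γ * τ * σ ^ 2 < γ * τ * ‖L‖ ^ 2 := by gcongr
      _ ≤ 1 / ‖L‖ ^ 2 * ‖L‖ ^ 2 := by gcongr
      _ = 1 := by field_simp
  by_cases hlt : γ * τ < 1 / ‖L‖ ^ 2
  · left
    refine ⟨?_, ?_⟩
    · calc γ * τ * σ ^ 2 ≤ γ * τ * ‖L‖ ^ 2 := by gcongr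
        _ < 1 / ‖L‖ ^ 2 * ‖L‖ ^ 2 := by gcongr
        _ = 1 := by field_simp
    · rw [eta, if_pos hlt]
      split_ifs with hneg
      · linarith [theta_le_theta_of_neg (γ := γ) (τ := τ) hneg hlast0 hlast]
      · linarith [theta_le_theta_of_nonneg (γ := γ) (τ := τ) (not_lt.1 hneg) hσ0.le hσN]
  have heq : γ * τ * ‖L‖ ^ 2 = 1 := by
    rw [le_antisymm hle (not_lt.1 hlt)]
    field_simp
  have hθN := theta_eq_abs (βP := βP) (βD := βD) hγ hτ heq
  rw [eta, if_neg hlt]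
  rcases hσN.eq_or_lt with rfl | hσlt
  · right
    refine ⟨heq, ?_⟩
    split_ifs with hd hneg hmin
    · exact le_rfl
    -- `κ(σ_d) ≤ κ(‖L‖) = 1 + w - |w| ≤ 1 + 2w`, where `w` is half of `βP/γ + βD/τ`.
    · have h1 := theta_le_theta_of_neg (γ := γ) (τ := τ) hneg hlast0 hlast
      rw [hθN] at h1
      rw [hhalf γ, hhalf τ]
      linarith [neg_abs_le (1 / (2 * γ) * βP + 1 / (2 * τ) * βD)]
    · have hP : 0 ≤ βP := le_trans hmin (min_le_left _ _)
      have hD : 0 ≤ βD := le_trans hmin (min_le_right _ _)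
      have h1 : 0 ≤ 1 / (2 * γ) * βP := by positivity
      have h2 : 0 ≤ 1 / (2 * τ) * βD := by positivity
      have h3 : 0 ≤ theta βP βD γ τ (sigmaSecond L) := Real.sqrt_nonneg _
      rw [hhalf γ, hhalf τ]
      linarith
    · exact le_rfl
  · left
    refine ⟨hlt_of hσlt, ?_⟩
    have hd : numSV L ≠ 1 := by
      intro h1
      obtain ⟨a, ha⟩ := Set.ncard_eq_one.1 h1
      rw [ha] at hσ hnorm
      exact hσlt.ne (hσ.trans hnorm.symm)
    rw [if_neg hd]
    split_ifs with hneg hmin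
    · linarith [theta_le_theta_of_neg (γ := γ) (τ := τ) hneg hlast0 hlast]
    · have hP : 0 ≤ βP := le_trans hmin (min_le_left _ _)
      have hD : 0 ≤ βD := le_trans hmin (min_le_right _ _)
      have hsec : σ ≤ sigmaSecond L := by
        refine le_csSup (hfin.subset (Set.sep_subset _ _)).bddAbove ⟨hσ, ?_⟩
        exact hσlt.trans_le (le_csSup hfin.bddAbove hnorm)
      linarith [theta_le_theta_of_nonneg (γ := γ) (τ := τ) (mul_nonneg hP hD) hσ0.le hsec]
    -- Both parameters are nonpositive here, so `κ(‖L‖)` equals the degenerate constant, and `κ`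
    -- only grows as `σ` decreases.
    · have hprod : 0 ≤ βP * βD := not_lt.1 hneg
      have hPD : βP ≤ 0 ∧ βD ≤ 0 := by
        rcases mul_nonneg_iff.1 hprod with h | h
        · exact absurd (le_min h.1 h.2) hmin
        · exact h
      have h1 := theta_le_theta_of_nonneg (γ := γ) (τ := τ) hprod hσ0.le hσlt.le
      have h2 : 1 / (2 * γ) * βP ≤ 0 := mul_nonpos_of_nonneg_of_nonpos (by positivity) hPD.1
      have h3 : 1 / (2 * τ) * βD ≤ 0 := mul_nonpos_of_nonneg_of_nonpos (by positivity) hPD.2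
      rw [hθN, abs_of_nonpos (by linarith)] at h1
      rw [hhalf γ, hhalf τ]
      linarith

theorem etaBar_le_eta (L : Rn n →L[ℝ] Rn m) (βP βP' βD βD' γ τ : ℝ) :
    etaBar L βP βP' βD βD' γ τ ≤ eta L βP βD γ τ := by
  unfold etaBar etaPrime
  split_ifs <;> simp only [← EReal.coe_strictMono.monotone.map_min, EReal.toReal_coe, min_top_right] <;>
    grind

/-- A nonzero kernel vector forces `r < n`, which is exactly when the primal term enters `η'`. -/
theorem etaBar_le_primal (L : Rn n →L[ℝ] Rn m) (βP βP' βD βD' γ τ : ℝ) {x : Rn n} (hx : x ≠ 0)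
    (h : L x = 0) : etaBar L βP βP' βD βD' γ τ ≤ 1 + 1 / γ * βP' := by
  have hr : rankL L ≠ n := by
    intro hr
    have h1 := L.toLinearMap.finrank_range_add_finrank_ker
    have h2 : Module.finrank ℝ (LinearMap.ker L.toLinearMap) = 0 := by
      unfold rankL at hr
      rw [finrank_euclideanSpace_fin] at h1
      omega
    have h3 : x ∈ LinearMap.ker L.toLinearMap := h
    rw [Submodule.finrank_eq_zero.1 h2, Submodule.mem_bot] at h3
    exact hx h3
  unfold etaBar etaPrime
  rw [if_neg hr, if_neg hr]
  split_ifs <;> simp only [← EReal.coe_strictMono.monotone.map_min, EReal.toReal_coe] <;>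
    grind

theorem etaBar_le_dual (L : Rn n →L[ℝ] Rn m) (βP βP' βD βD' γ τ : ℝ) {y : Rn m} (hy : y ≠ 0)
    (h : trL L y = 0) : etaBar L βP βP' βD βD' γ τ ≤ 1 + 1 / τ * βD' := by
  have hr : rankL L ≠ m := by
    intro hr
    have h1 : LinearMap.range L.toLinearMap = ⊤ := by
      apply Submodule.eq_top_of_finrank_eq
      rw [finrank_euclideanSpace_fin]
      exact hr
    obtain ⟨x, hx⟩ : y ∈ LinearMap.range L.toLinearMap := by
      rw [h1]
      trivial
    have h2 : inner ℝ (trL L y) x = inner ℝ y y := by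
      rw [inner_trL_left]
      exact congrArg _ hx
    rw [h, inner_zero_left] at h2
    exact hy (inner_self_eq_zero.1 h2.symm)
  unfold etaBar etaPrime
  rw [if_neg hr]
  split_ifs <;> simp only [← EReal.coe_strictMono.monotone.map_min, EReal.toReal_coe] <;>
    grind

end ChambollePock

/-! ### Symmetric maps and projection onto their range -/

section SymmetricMap

variable {E : Type*} [NormedAddCommGroup E] [InnerProductSpace ℝ E] [FiniteDimensional ℝ E]

theorem continuous_of_linearMap_of_finiteDimensional (M : E →ₗ[ℝ] E) : Continuous M :=
  M.continuous_of_finiteDimensional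

/-- The projection onto the range of a symmetric map factors through the map. -/
theorem exists_starProjection_range_eq_comp {M : E →ₗ[ℝ] E} (hM : M.IsSymmetric) :
    ∃ G : E → E, Continuous G ∧ ∀ z, (LinearMap.range M).starProjection z = G (M z) := by
  let P : E →ₗ[ℝ] E := (LinearMap.range M).starProjection.toLinearMap
  -- By symmetry `ker M ⟂ range M`, so the projection descends to `E ⧸ ker M ≃ range M`; a linear
  -- extension to `E` then gives `G`.
  have hker : LinearMap.ker M ≤ LinearMap.ker P := by
    intro z hz
    refine (Submodule.starProjection_apply_eq_zero_iff _).2 ((Submodule.mem_orthogonal _ _).2 ?_)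
    rintro _ ⟨w, rfl⟩
    rw [hM, LinearMap.mem_ker.1 hz, inner_zero_right]
  obtain ⟨G, hG⟩ :=
    LinearMap.exists_extend ((LinearMap.ker M).liftQ P hker ∘ₗ M.quotKerEquivRange.symm.toLinearMap)
  refine ⟨G, G.continuous_of_finiteDimensional, fun z => ?_⟩
  have h := LinearMap.congr_fun hG ⟨M z, z, rfl⟩
  have h2 : M.quotKerEquivRange.symm ⟨M z, z, rfl⟩ = (LinearMap.ker M).mkQ z :=
    M.quotKerEquivRange_symm_apply_image z _
  simp only [LinearMap.comp_apply, LinearEquiv.coe_coe, h2, Submodule.subtype_apply,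
    Submodule.mkQ_apply, Submodule.liftQ_apply] at h
  exact h.symm

end SymmetricMap

namespace ChambollePock

variable {n m : ℕ}

/-! ### The preconditioner -/

theorem precond_fst (L : Rn n →L[ℝ] Rn m) (γ τ : ℝ) (z : Rnm n m) :
    (precond L γ τ z).fst = (1 / γ) • z.fst - trL L z.snd := rfl

theorem precond_snd (L : Rn n →L[ℝ] Rn m) (γ τ : ℝ) (z : Rnm n m) :
    (precond L γ τ z).snd = -(L z.fst) + (1 / τ) • z.snd := rfl

theorem inner_eq_fst_add_snd (z w : Rnm n m) :
    inner ℝ z w = inner ℝ z.fst w.fst + inner ℝ z.snd w.snd :=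
  WithLp.prod_inner_apply z w

theorem norm_sq_eq_fst_add_snd (z : Rnm n m) : ‖z‖ ^ 2 = ‖z.fst‖ ^ 2 + ‖z.snd‖ ^ 2 := by
  simp only [← real_inner_self_eq_norm_sq, inner_eq_fst_add_snd]

theorem isSymmetric_precond (L : Rn n →L[ℝ] Rn m) (γ τ : ℝ) : (precond L γ τ).IsSymmetric := by
  intro z w
  simp only [inner_eq_fst_add_snd, precond_fst, precond_snd, inner_sub_left, inner_sub_right,
    inner_add_left, inner_add_right, inner_neg_left, inner_neg_right, real_inner_smul_left,
    real_inner_smul_right, inner_trL_left, inner_trL_right]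
  rw [real_inner_comm (L w.fst) z.snd]
  ring

theorem inner_precond_self (L : Rn n →L[ℝ] Rn m) (γ τ : ℝ) (z : Rnm n m) :
    inner ℝ (precond L γ τ z) z
      = ‖z.fst‖ ^ 2 / γ - 2 * inner ℝ (L z.fst) z.snd + ‖z.snd‖ ^ 2 / τ := by
  simp only [inner_eq_fst_add_snd, precond_fst, precond_snd, inner_sub_left,
    inner_add_left, inner_neg_left, real_inner_smul_left,
    inner_trL_left, real_inner_self_eq_norm_sq]
  rw [real_inner_comm (L z.fst) z.snd]
  ring

theorem norm_sq_map_le (L : Rn n →L[ℝ] Rn m) {c : ℝ} (hc : ‖L‖ ^ 2 ≤ c) (x : Rn n) :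
    ‖L x‖ ^ 2 ≤ c * ‖x‖ ^ 2 :=
  calc ‖L x‖ ^ 2 ≤ (‖L‖ * ‖x‖) ^ 2 := pow_le_pow_left₀ (norm_nonneg _) (L.le_opNorm x) 2
    _ = ‖L‖ ^ 2 * ‖x‖ ^ 2 := mul_pow _ _ _
    _ ≤ c * ‖x‖ ^ 2 := by gcongr

/-- The cross terms on both sides agree, leaving only `‖L x‖² ≤ ‖x‖² / (γτ)` and its dual. Besides
yielding positivity of `M`, this lets the seminorm control `M u`. -/
theorem norm_precond_sq_le (L : Rn n →L[ℝ] Rn m) {γ τ : ℝ} (hγ : 0 < γ) (hτ : 0 < τ)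
    (h : ‖L‖ ^ 2 ≤ 1 / (γ * τ)) (z : Rnm n m) :
    ‖precond L γ τ z‖ ^ 2 ≤ (1 / γ + 1 / τ) * inner ℝ (precond L γ τ z) z := by
  have h1 := norm_sq_map_le L h z.fst
  have h2 := norm_sq_map_le (trL L) (c := 1 / (γ * τ))
    (by rwa [show ‖trL L‖ = ‖L‖ from LinearIsometryEquiv.norm_map _ L]) z.snd
  rw [inner_precond_self, norm_sq_eq_fst_add_snd, precond_fst, precond_snd, norm_sub_sq_real,
    norm_add_sq_real, norm_smul, norm_smul, norm_neg, mul_pow, mul_pow, real_inner_smul_left,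
    real_inner_smul_right, inner_neg_left, inner_trL_right]
  simp only [Real.norm_eq_abs, sq_abs]
  set a := ‖z.fst‖ ^ 2
  set b := ‖z.snd‖ ^ 2
  set c : ℝ := inner ℝ (L z.fst) z.snd
  have e : (1 / γ + 1 / τ) * (a / γ - 2 * c + b / τ)
      = ((1 / γ) ^ 2 * a - 2 * (1 / γ * c) + 1 / (γ * τ) * b)
        + (1 / (γ * τ) * a + 2 * (1 / τ * -c) + (1 / τ) ^ 2 * b) := by
    field_simp
    ring
  rw [e]
  gcongr

theorem inner_precond_self_nonneg (L : Rn n →L[ℝ] Rn m) {γ τ : ℝ} (hγ : 0 < γ) (hτ : 0 < τ)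
    (h : ‖L‖ ^ 2 ≤ 1 / (γ * τ)) (z : Rnm n m) : 0 ≤ inner ℝ (precond L γ τ z) z :=
  nonneg_of_mul_nonneg_right ((sq_nonneg _).trans (norm_precond_sq_le L hγ hτ h z))
    (by positivity)

/-- The diagonal map with blocks `f` and `g`. -/
noncomputable def diagMap (f : Rn n →L[ℝ] Rn n) (g : Rn m →L[ℝ] Rn m) :
    Rnm n m →ₗ[ℝ] Rnm n m :=
  (WithLp.linearEquiv 2 ℝ (Rn n × Rn m)).symm.toLinearMap ∘ₗ
    (f.toLinearMap.prodMap g.toLinearMap) ∘ₗ (WithLp.linearEquiv 2 ℝ (Rn n × Rn m)).toLinearMap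

theorem diagMap_fst (f : Rn n →L[ℝ] Rn n) (g : Rn m →L[ℝ] Rn m) (z : Rnm n m) :
    (diagMap f g z).fst = f z.fst := rfl

theorem diagMap_snd (f : Rn n →L[ℝ] Rn n) (g : Rn m →L[ℝ] Rn m) (z : Rnm n m) :
    (diagMap f g z).snd = g z.snd := rfl

theorem ext_fst_snd {z w : Rnm n m} (h1 : z.fst = w.fst) (h2 : z.snd = w.snd) : z = w :=
  WithLp.ofLp_injective 2 (Prod.ext h1 h2)

theorem Vmap_eq_diagMap (L : Rn n →L[ℝ] Rn m) (βP βP' βD βD' : ℝ) (z : Rnm n m) :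
    Vmap L βP βP' βD βD' z = diagMap (blockV L βP βP') (blockV (trL L) βD βD') z :=
  Vmap_eq L βP βP' βD βD' z

theorem trL_map_blockV (L : Rn n →L[ℝ] Rn m) (b b' : ℝ) (x : Rn n) :
    blockV L b b' (trL L (L x)) = trL L (L (blockV L b b' x)) := by
  rw [blockV_trL, map_blockV, map_smul]

theorem map_trL_blockV (L : Rn n →L[ℝ] Rn m) (b b' : ℝ) (y : Rn m) :
    blockV (trL L) b b' (L (trL L y)) = L (trL L (blockV (trL L) b b' y)) := by
  have := trL_map_blockV (trL L) b b' y
  rwa [trL_trL] at this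

/-- An eigenvector of `LᵀL` with nonzero eigenvalue lies in the range of `Lᵀ`, where the block is
the scalar `b`. -/
theorem blockV_of_eigenvector (L : Rn n →L[ℝ] Rn m) (b b' : ℝ) {s : ℝ} (hs : s ≠ 0) {x : Rn n}
    (hx : trL L (L x) = s • x) : blockV L b b' x = b • x := by
  have h : x = trL L (s⁻¹ • L x) := by rw [map_smul, hx, inv_smul_smul₀ hs]
  rw [h, blockV_trL]

/-- The eigenvalue bound `M + M V M ≥ η̄ M`. -/
theorem etaBar_mul_inner_le (L : Rn n →L[ℝ] Rn m) (hL : L ≠ 0) {βP βP' βD βD' γ τ : ℝ}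
    (hγ : 0 < γ) (hτ : 0 < τ) (hle : γ * τ ≤ 1 / ‖L‖ ^ 2) (u : Rnm n m) :
    etaBar L βP βP' βD βD' γ τ * inner ℝ (precond L γ τ u) u ≤
      inner ℝ (precond L γ τ u) u +
        inner ℝ (precond L γ τ u) (Vmap L βP βP' βD βD' (precond L γ τ u)) := by
  set η := etaBar L βP βP' βD βD' γ τ with hη
  set M := precond L γ τ with hM
  set W := diagMap (blockV L βP βP') (blockV (trL L) βD βD') with hW
  let K : Rnm n m →ₗ[ℝ] Rnm n m := diagMap (trL L ∘L L) (L ∘L trL L)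
  have hK : K.IsSymmetric := by
    intro z w
    simp only [inner_eq_fst_add_snd]
    change inner ℝ (trL L (L z.fst)) w.fst + inner ℝ (L (trL L z.snd)) w.snd
      = inner ℝ z.fst (trL L (L w.fst)) + inner ℝ z.snd (L (trL L w.snd))
    rw [inner_trL_left L w.fst, inner_trL_right L z.fst, ← inner_trL_right L (trL L z.snd) w.snd,
      ← inner_trL_left L (trL L w.snd) z.snd]
  have hKM : ∀ z, M (K z) = K (M z) := by
    intro z
    refine ext_fst_snd ?_ ?_
    · change (1 / γ) • trL L (L z.fst) - trL L (L (trL L z.snd))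
        = trL L (L ((1 / γ) • z.fst - trL L z.snd))
      simp only [map_sub, map_smul]
    · change -(L (trL L (L z.fst))) + (1 / τ) • L (trL L z.snd)
        = L (trL L (-(L z.fst) + (1 / τ) • z.snd))
      simp only [map_add, map_smul, map_neg]
  have hKW : ∀ z, W (K z) = K (W z) := fun z =>
    ext_fst_snd (trL_map_blockV L βP βP' z.fst) (map_trL_blockV L βD βD' z.snd)
  -- The claim is positivity of this operator, which commutes with `K` because `M` and `W` do.
  let Q : Rnm n m →ₗ[ℝ] Rnm n m := (1 - η) • M + M ∘ₗ W ∘ₗ M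
  have hQ : ∀ z, inner ℝ (Q z) z
      = (1 - η) * inner ℝ (M z) z + inner ℝ (M z) (W (M z)) := by
    intro z
    change inner ℝ ((1 - η) • M z + M (W (M z))) z = _
    rw [inner_add_left, real_inner_smul_left, isSymmetric_precond L γ τ (W (M z)) z, real_inner_comm (M z)]
  have key : 0 ≤ inner ℝ (Q u) u := by
    refine inner_map_self_nonneg_of_commute hK (fun z => ?_) (fun s z hz => ?_) u
    · change (1 - η) • M (K z) + M (W (M (K z))) = K ((1 - η) • M z + M (W (M z)))
      rw [map_add, map_smul, ← hKM, ← hKM, ← hKW, ← hKM]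
    · rw [hQ]
      have hx : trL L (L z.fst) = s • z.fst := congrArg WithLp.fst hz
      have hy : L (trL L z.snd) = s • z.snd := congrArg WithLp.snd hz
      have hMz : K (M z) = s • M z := by rw [← hKM, hz, map_smul]
      have hp : trL L (L (M z).fst) = s • (M z).fst := congrArg WithLp.fst hMz
      have hq : L (trL L (M z).snd) = s • (M z).snd := congrArg WithLp.snd hMz
      have hy' : trL (trL L) (trL L z.snd) = s • z.snd := by rw [trL_trL, hy]
      have hq' : trL (trL L) (trL L (M z).snd) = s • (M z).snd := by rw [trL_trL, hq]
      rcases lt_trichotomy s 0 with hs | rfl | hs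
      · have h1 : z.fst = 0 := by
          by_contra h0
          exact absurd (eigenvalue_nonneg L h0 hx) (not_le.2 hs)
        have h2 : z.snd = 0 := by
          by_contra h0
          exact absurd (eigenvalue_nonneg (trL L) h0 hy') (not_le.2 hs)
        have h3 : z = 0 := ext_fst_snd h1 h2
        simp [h3]
      · have hLx : L z.fst = 0 := by
          have := norm_sq_map_eq L hx
          simpa using this
        have hLy : trL L z.snd = 0 := by
          have := norm_sq_map_eq (trL L) hy'
          simpa using this
        have hp1 : (M z).fst = (1 / γ) • z.fst := by rw [hM, precond_fst, hLy, sub_zero]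
        have hq1 : (M z).snd = (1 / τ) • z.snd := by rw [hM, precond_snd, hLx, neg_zero, zero_add]
        rw [inner_eq_fst_add_snd, inner_eq_fst_add_snd, hW, diagMap_fst, diagMap_snd, hp1, hq1,
          map_smul, map_smul, blockV_of_map_eq_zero L _ _ hLx,
          blockV_of_map_eq_zero (trL L) _ _ hLy]
        simp only [real_inner_smul_left, real_inner_smul_right, real_inner_self_eq_norm_sq]
        have h1 : 0 ≤ (1 + 1 / γ * βP' - η) * ‖z.fst‖ ^ 2 := by
          rcases eq_or_ne z.fst 0 with h0 | h0
          · simp [h0]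
          · exact mul_nonneg (sub_nonneg.2 (etaBar_le_primal L _ _ _ _ _ _ h0 hLx)) (sq_nonneg _)
        have h2 : 0 ≤ (1 + 1 / τ * βD' - η) * ‖z.snd‖ ^ 2 := by
          rcases eq_or_ne z.snd 0 with h0 | h0
          · simp [h0]
          · exact mul_nonneg (sub_nonneg.2 (etaBar_le_dual L _ _ _ _ _ _ h0 hLy)) (sq_nonneg _)
        have h3 := mul_nonneg (one_div_pos.2 hγ).le h1
        have h4 := mul_nonneg (one_div_pos.2 hτ).le h2
        linarith
      · rcases eq_or_ne z 0 with rfl | hz0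
        · simp
        -- One component of `z` may vanish, so the singular value is read off from whichever
        -- component is nonzero.
        have hσ : √s ∈ posSingularValues L := by
          by_cases h0 : z.fst = 0
          · refine sqrt_mem_posSingularValues' L hs (y := z.snd) (fun h1 => ?_) hy
            exact hz0 (ext_fst_snd h0 h1)
          · exact sqrt_mem_posSingularValues L hs h0 hx
        have hle' := etaBar_le_eta L βP βP' βD βD' γ τ
        have hcases := eta_le L hL (βP := βP) (βD := βD) hγ hτ hle hσ
        rw [Real.sq_sqrt hs.le] at hcases
        have hblock := block_form_nonneg L (βP := βP) (βD := βD) (η := η) hγ hτ hs hx hy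
          (hcases.imp (And.imp_right hle'.trans) (And.imp_right hle'.trans))
        rw [inner_eq_fst_add_snd, inner_eq_fst_add_snd, hW, diagMap_fst, diagMap_snd,
          blockV_of_eigenvector L _ _ hs.ne' hp, blockV_of_eigenvector (trL L) _ _ hs.ne' hq',
          real_inner_smul_right, real_inner_smul_right, real_inner_self_eq_norm_sq,
          real_inner_self_eq_norm_sq, ← add_assoc]
        exact hblock
  rw [hQ, ← Vmap_eq_diagMap] at key
  linarith

/-! ### Projection onto the range of the preconditioner -/

/-- The residual `z - P z` is orthogonal to the range of `M`, hence in `ker M` by symmetry. -/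
theorem precond_projRangeP (L : Rn n →L[ℝ] Rn m) (γ τ : ℝ) (z : Rnm n m) :
    precond L γ τ (projRangeP L γ τ z) = precond L γ τ z := by
  have h : z - projRangeP L γ τ z ∈ (LinearMap.range (precond L γ τ))ᗮ :=
    Submodule.sub_starProjection_mem_orthogonal z
  have h1 : inner ℝ (precond L γ τ (precond L γ τ (z - projRangeP L γ τ z)))
      (z - projRangeP L γ τ z) = 0 :=
    (Submodule.mem_orthogonal _ _).1 h _ ⟨_, rfl⟩
  rw [isSymmetric_precond L γ τ, inner_self_eq_zero, map_sub, sub_eq_zero] at h1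
  exact h1.symm

theorem projRangeP_sub (L : Rn n →L[ℝ] Rn m) (γ τ : ℝ) (z w : Rnm n m) :
    projRangeP L γ τ (z - w) = projRangeP L γ τ z - projRangeP L γ τ w :=
  map_sub _ z w

theorem continuous_projRangeP (L : Rn n →L[ℝ] Rn m) (γ τ : ℝ) :
    Continuous (projRangeP L γ τ) :=
  ContinuousLinearMap.continuous _

theorem continuous_precond (L : Rn n →L[ℝ] Rn m) (γ τ : ℝ) : Continuous (precond L γ τ) :=
  continuous_of_linearMap_of_finiteDimensional (precond L γ τ)

theorem exists_projRangeP_eq_comp (L : Rn n →L[ℝ] Rn m) (γ τ : ℝ) :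
    ∃ G : Rnm n m → Rnm n m, Continuous G ∧ ∀ z, projRangeP L γ τ z = G (precond L γ τ z) :=
  exists_starProjection_range_eq_comp (isSymmetric_precond L γ τ)

end ChambollePock

/-! ### Fejér monotonicity in a seminorm -/

section Fejer

variable {E : Type*} [NormedAddCommGroup E] [InnerProductSpace ℝ E]
  {M : E →ₗ[ℝ] E} {C η : ℝ} {z zb : ℕ → E} {lam : ℕ → ℝ} {q : E}

theorem inner_relaxed_step_le (hM : M.IsSymmetric) {u e : E} {t : ℝ} (ht : 0 ≤ t)
    (h : η * inner ℝ (M u) u ≤ inner ℝ (M u) e) :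
    inner ℝ (M (e - t • u)) (e - t • u)
      ≤ inner ℝ (M e) e - t * (2 * η - t) * inner ℝ (M u) u := by
  have h1 : inner ℝ (M e) u = inner ℝ (M u) e := by rw [hM, real_inner_comm]
  have h2 := mul_le_mul_of_nonneg_left h ht
  simp only [map_sub, map_smul, inner_sub_left, inner_sub_right, real_inner_smul_left,
    real_inner_smul_right, h1]
  linarith

theorem inner_iterate_succ_le (hM : M.IsSymmetric) (hlam : ∀ k, 0 ≤ lam k)
    (hz : ∀ k, z (k + 1) = z k + lam k • (zb k - z k))
    (hq : ∀ k, η * inner ℝ (M (z k - zb k)) (z k - zb k) ≤ inner ℝ (M (z k - zb k)) (z k - q))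
    (k : ℕ) : inner ℝ (M (z (k + 1) - q)) (z (k + 1) - q) ≤ inner ℝ (M (z k - q)) (z k - q)
      - lam k * (2 * η - lam k) * inner ℝ (M (z k - zb k)) (z k - zb k) := by
  have e : z (k + 1) - q = (z k - q) - lam k • (z k - zb k) := by
    rw [hz, smul_sub, smul_sub]
    abel
  rw [e]
  exact inner_relaxed_step_le hM (hlam k) (hq k)

theorem antitone_inner_iterate (hM : M.IsSymmetric) (hnn : ∀ u, 0 ≤ inner ℝ (M u) u)
    (hlam : ∀ k, lam k ∈ Set.Ioo 0 (2 * η)) (hz : ∀ k, z (k + 1) = z k + lam k • (zb k - z k))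
    (hq : ∀ k, η * inner ℝ (M (z k - zb k)) (z k - zb k) ≤ inner ℝ (M (z k - zb k)) (z k - q)) :
    Antitone fun k => inner ℝ (M (z k - q)) (z k - q) := by
  refine antitone_nat_of_succ_le fun k => ?_
  have h1 := inner_iterate_succ_le hM (fun k => (hlam k).1.le) hz hq k
  have h2 : 0 ≤ lam k * (2 * η - lam k) * inner ℝ (M (z k - zb k)) (z k - zb k) :=
    mul_nonneg (mul_nonneg (hlam k).1.le (sub_nonneg.2 (hlam k).2.le)) (hnn _)
  linarith

theorem tendsto_zero_of_inner_tendsto_zero (hC : ∀ u, ‖M u‖ ^ 2 ≤ C * inner ℝ (M u) u)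
    {u : ℕ → E} (hu : Tendsto (fun k => inner ℝ (M (u k)) (u k)) atTop (𝓝 0)) :
    Tendsto (fun k => M (u k)) atTop (𝓝 0) := by
  rw [tendsto_zero_iff_norm_tendsto_zero]
  have h1 : Tendsto (fun k => ‖M (u k)‖ ^ 2) atTop (𝓝 0) :=
    squeeze_zero (fun _ => sq_nonneg _) (fun k => hC (u k)) (by simpa using hu.const_mul C)
  have h2 := h1.sqrt
  simpa using h2

/-- The squared seminorm distances to `q` decrease and converge, so their increments vanish;
eventually each increment dominates a fixed `ε > 0` times `⟪M u, u⟫`. -/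
theorem tendsto_residual (hM : M.IsSymmetric) (hnn : ∀ u, 0 ≤ inner ℝ (M u) u)
    (hC : ∀ u, ‖M u‖ ^ 2 ≤ C * inner ℝ (M u) u)
    (hlam : ∀ k, lam k ∈ Set.Ioo 0 (2 * η))
    (hliminf : 0 < liminf (fun k => lam k * (2 * η - lam k)) atTop)
    (hz : ∀ k, z (k + 1) = z k + lam k • (zb k - z k))
    (hq : ∀ k, η * inner ℝ (M (z k - zb k)) (z k - zb k) ≤ inner ℝ (M (z k - zb k)) (z k - q)) :
    Tendsto (fun k => M (z k - zb k)) atTop (𝓝 0) := by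
  refine tendsto_zero_of_inner_tendsto_zero hC ?_
  set a : ℕ → ℝ := fun k => inner ℝ (M (z k - q)) (z k - q) with ha
  obtain ⟨ε, hε, hεlim⟩ := exists_between hliminf
  have hev : ∀ᶠ k in atTop, ε < lam k * (2 * η - lam k) :=
    eventually_lt_of_lt_liminf hεlim (isBoundedUnder_of
      ⟨0, fun k => mul_nonneg (hlam k).1.le (sub_nonneg.2 (hlam k).2.le)⟩)
  have hlim : Tendsto a atTop (𝓝 (⨅ k, a k)) :=
    tendsto_atTop_ciInf (antitone_inner_iterate hM hnn hlam hz hq)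
      ⟨0, by rintro _ ⟨k, rfl⟩; exact hnn _⟩
  have hdiff : Tendsto (fun k => (a k - a (k + 1)) / ε) atTop (𝓝 0) := by
    have := (hlim.sub (hlim.comp (tendsto_add_atTop_nat 1))).div_const ε
    simpa using this
  refine squeeze_zero' (Eventually.of_forall fun _ => hnn _) ?_ hdiff
  filter_upwards [hev] with k hk
  rw [le_div_iff₀ hε]
  have h1 := inner_iterate_succ_le hM (fun k => (hlam k).1.le) hz hq k
  have h2 := mul_le_mul_of_nonneg_right hk.le (hnn (z k - zb k))
  simp only [ha]
  linarith

theorem isBounded_range_map_iterate (hM : M.IsSymmetric) (hnn : ∀ u, 0 ≤ inner ℝ (M u) u)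
    (hC0 : 0 ≤ C) (hC : ∀ u, ‖M u‖ ^ 2 ≤ C * inner ℝ (M u) u)
    (hlam : ∀ k, lam k ∈ Set.Ioo 0 (2 * η))
    (hz : ∀ k, z (k + 1) = z k + lam k • (zb k - z k))
    (hq : ∀ k, η * inner ℝ (M (z k - zb k)) (z k - zb k) ≤ inner ℝ (M (z k - zb k)) (z k - q)) :
    Bornology.IsBounded (Set.range fun k => M (z k)) := by
  refine (Metric.isBounded_closedBall (x := M q)
    (r := √(C * inner ℝ (M (z 0 - q)) (z 0 - q)))).subset ?_
  rintro _ ⟨k, rfl⟩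
  rw [Metric.mem_closedBall, dist_eq_norm, ← map_sub]
  refine Real.le_sqrt_of_sq_le ((hC _).trans ?_)
  exact mul_le_mul_of_nonneg_left (antitone_inner_iterate hM hnn hlam hz hq (Nat.zero_le k)) hC0

/-- `⟪M e, e⟫` is a continuous function of `M e`, so the distances tend to `0` along the
subsequence, and by monotonicity along the whole sequence. -/
theorem tendsto_map_iterate_of_subseq [FiniteDimensional ℝ E] (hM : M.IsSymmetric)
    (hnn : ∀ u, 0 ≤ inner ℝ (M u) u) (hC : ∀ u, ‖M u‖ ^ 2 ≤ C * inner ℝ (M u) u)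
    (hlam : ∀ k, lam k ∈ Set.Ioo 0 (2 * η))
    (hz : ∀ k, z (k + 1) = z k + lam k • (zb k - z k))
    (hq : ∀ k, η * inner ℝ (M (z k - zb k)) (z k - zb k) ≤ inner ℝ (M (z k - zb k)) (z k - q))
    {φ : ℕ → ℕ} (hφ : StrictMono φ) (hφz : Tendsto (fun k => M (z (φ k))) atTop (𝓝 (M q))) :
    Tendsto (fun k => M (z k)) atTop (𝓝 (M q)) := by
  obtain ⟨G, hG, hGM⟩ := exists_starProjection_range_eq_comp hM
  have hinner : ∀ e, inner ℝ (M e) e = inner ℝ (M e) (G (M e)) := by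
    intro e
    have h := Submodule.sub_starProjection_mem_orthogonal (K := LinearMap.range M) e
    have h1 := (Submodule.mem_orthogonal _ _).1 h (M e) ⟨e, rfl⟩
    rw [inner_sub_right, sub_eq_zero, hGM] at h1
    exact h1
  have hsub : Tendsto (fun k => M (z (φ k) - q)) atTop (𝓝 0) := by
    simpa using hφz.sub_const (M q)
  have hsub' : Tendsto (fun k => inner ℝ (M (z (φ k) - q)) (z (φ k) - q)) atTop (𝓝 0) := by
    have h1 := hsub.inner (𝕜 := ℝ) ((hG.tendsto 0).comp hsub)
    rw [inner_zero_left] at h1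
    exact h1.congr fun k => (hinner _).symm
  have hlim := tendsto_atTop_ciInf (antitone_inner_iterate hM hnn hlam hz hq)
    ⟨0, by rintro _ ⟨k, rfl⟩; exact hnn _⟩
  rw [tendsto_nhds_unique (hlim.comp hφ.tendsto_atTop) hsub'] at hlim
  have h2 := tendsto_zero_of_inner_tendsto_zero hC hlim
  simpa using h2.add_const (M q)

end Fejer

/-- A relaxed iteration with relaxation bounded in `(0, 2)` converges to the limit of its
targets. -/
theorem tendsto_of_relaxation {E : Type*} [NormedAddCommGroup E] [NormedSpace ℝ E]
    {z zb : ℕ → E} {lam : ℕ → ℝ} {q : E} {ε : ℝ} (hε : 0 < ε)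
    (hlam : ∀ k, ε ≤ lam k ∧ lam k ≤ 2 - ε) (hz : ∀ k, z (k + 1) = z k + lam k • (zb k - z k))
    (hzb : Tendsto zb atTop (𝓝 q)) : Tendsto z atTop (𝓝 q) := by
  have hε1 : ε ≤ 1 := by linarith [(hlam 0).1, (hlam 0).2]
  have hstep : ∀ k, ‖z (k + 1) - q‖ ≤ (1 - ε) * ‖z k - q‖ + 2 * ‖zb k - q‖ := by
    intro k
    have e : z (k + 1) - q = (1 - lam k) • (z k - q) + lam k • (zb k - q) := by
      rw [hz]
      module
    have h1 : |1 - lam k| ≤ 1 - ε := abs_le.2 ⟨by linarith [(hlam k).2], by linarith [(hlam k).1]⟩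
    have h2 : |lam k| ≤ 2 := abs_le.2 ⟨by linarith [(hlam k).1], by linarith [(hlam k).2]⟩
    rw [e]
    refine (norm_add_le _ _).trans ?_
    rw [norm_smul, norm_smul, Real.norm_eq_abs, Real.norm_eq_abs]
    gcongr
  rw [tendsto_iff_norm_sub_tendsto_zero] at hzb ⊢
  rw [Metric.tendsto_atTop]
  intro δ hδ
  -- The tolerance `εδ/4` makes the forcing at most `εδ/2`, so that `δ/2` is a fixed point of `t ↦
  -- (1 - ε) t + εδ/2`.
  obtain ⟨N, hN⟩ := Metric.tendsto_atTop.1 hzb (ε * δ / 4) (by positivity)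
  have hgeom : ∀ j, ‖z (N + j) - q‖ ≤ δ / 2 + (1 - ε) ^ j * ‖z N - q‖ := by
    intro j
    induction j with
    | zero => simp; linarith
    | succ j ih =>
      have h1 := hstep (N + j)
      have h2 := hN (N + j) (by omega)
      rw [Real.dist_0_eq_abs, abs_of_nonneg (norm_nonneg _)] at h2
      have h3 := mul_le_mul_of_nonneg_left ih (by linarith : 0 ≤ 1 - ε)
      rw [pow_succ, ← add_assoc]
      linarith
  have hpow : Tendsto (fun j => (1 - ε) ^ j * ‖z N - q‖) atTop (𝓝 0) := by
    have := (tendsto_pow_atTop_nhds_zero_of_lt_one (r := 1 - ε) (by linarith)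
      (by linarith)).mul_const ‖z N - q‖
    simpa using this
  obtain ⟨J, hJ⟩ := (hpow.eventually (gt_mem_nhds (half_pos hδ))).exists_forall_of_atTop
  refine ⟨N + J, fun k hk => ?_⟩
  obtain ⟨j, rfl⟩ := Nat.exists_eq_add_of_le (show N ≤ k by omega)
  rw [Real.dist_0_eq_abs, abs_of_nonneg (norm_nonneg _)]
  linarith [hgeom j, hJ j (by omega)]

namespace ChambollePock

variable {n m : ℕ}

/-! ### The algorithm -/

section Algorithm

variable {A : Rn n → Set (Rn n)} {B : Rn m → Set (Rn m)} {L : Rn n →L[ℝ] Rn m} {γ τ : ℝ}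
  {lam : ℕ → ℝ} {z zb : ℕ → Rnm n m}

theorem IsCPSequence.succ_eq (h : IsCPSequence A B L γ τ lam z zb) (k : ℕ) :
    z (k + 1) = z k + lam k • (zb k - z k) :=
  ext_fst_snd (h k).2.2.1 (h k).2.2.2

/-- Each resolvent step is an inclusion for `A` or `B⁻¹`. The extrapolation `2 x̄ - x` is what
cancels the off-diagonal `-L (x - x̄)` and leaves `-L x̄`. -/
theorem IsCPSequence.precond_mem (hγ : 0 < γ) (hτ : 0 < τ)
    (h : IsCPSequence A B L γ τ lam z zb) (k : ℕ) :
    precond L γ τ (z k - zb k) ∈ TPD A B L (zb k) := by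
  obtain ⟨⟨_, ⟨a, ha, rfl⟩, h1⟩, ⟨_, ⟨b, hb, rfl⟩, h2⟩, -, -⟩ := h k
  refine ⟨a, ha, b, hb, ext_fst_snd ?_ ?_⟩
  · change (1 / γ) • ((z k).fst - (zb k).fst) - trL L ((z k).snd - (zb k).snd)
      = a + trL L (zb k).snd
    have h3 : (z k).fst - (zb k).fst = γ • (a + trL L (z k).snd) := by
      rw [sub_eq_iff_eq_add] at h1
      rw [h1, smul_add]
      abel
    rw [h3, one_div, inv_smul_smul₀ hγ.ne', map_sub]
    abel
  · change -(L ((z k).fst - (zb k).fst)) + (1 / τ) • ((z k).snd - (zb k).snd)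
      = b - L (zb k).fst
    have h3 : (z k).snd - (zb k).snd = τ • (b - L ((2 : ℝ) • (zb k).fst - (z k).fst)) := by
      rw [← eq_sub_iff_add_eq] at h2
      rw [h2, smul_sub]
      abel
    rw [h3, one_div, inv_smul_smul₀ hτ.ne', map_sub, map_sub, map_smul, two_smul]
    abel

theorem tendsto_fst {u : ℕ → Rnm n m} {q : Rnm n m} (h : Tendsto u atTop (𝓝 q)) :
    Tendsto (fun k => (u k).fst) atTop (𝓝 q.fst) :=
  ((WithLp.prod_continuous_ofLp 2 (Rn n) (Rn m)).fst.tendsto q).comp h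

theorem tendsto_snd {u : ℕ → Rnm n m} {q : Rnm n m} (h : Tendsto u atTop (𝓝 q)) :
    Tendsto (fun k => (u k).snd) atTop (𝓝 q.snd) :=
  ((WithLp.prod_continuous_ofLp 2 (Rn n) (Rn m)).snd.tendsto q).comp h

theorem mem_zer_TPD_of_tendsto (hA : OuterSemicontinuous A) (hB : OuterSemicontinuous B)
    {u v : ℕ → Rnm n m} {q : Rnm n m} (hmem : ∀ k, v k ∈ TPD A B L (u k))
    (hu : Tendsto u atTop (𝓝 q)) (hv : Tendsto v atTop (𝓝 0)) : q ∈ zer (TPD A B L) := by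
  choose a ha b hb hab using hmem
  have ha' : ∀ k, a k = (v k).fst - trL L (u k).snd :=
    fun k => eq_sub_iff_add_eq.2 (congrArg WithLp.fst (hab k)).symm
  have hb' : ∀ k, b k = (v k).snd + L (u k).fst :=
    fun k => sub_eq_iff_eq_add.1 (congrArg WithLp.snd (hab k)).symm
  have hlima : Tendsto a atTop (𝓝 (0 - trL L q.snd)) := by
    rw [funext ha']
    exact (tendsto_fst hv).sub (((trL L).continuous.tendsto _).comp (tendsto_snd hu))
  have hlimb : Tendsto b atTop (𝓝 (0 + L q.fst)) := by
    rw [funext hb']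
    exact (tendsto_snd hv).add ((L.continuous.tendsto _).comp (tendsto_fst hu))
  refine ⟨_, hA _ _ _ a ha (tendsto_fst hu) hlima, _, hB _ _ b _ hb hlimb (tendsto_snd hu), ?_⟩
  exact ext_fst_snd (by simp) (by simp)

/-- The resolvent arguments are `γ (M z).fst` and `τ (M z).snd + 2τ L x̄`, so the `ker M` component
of `z` never influences `z̄`. -/
theorem IsCPSequence.exists_eq_comp_precond (hγ : 0 < γ) (hτ : 0 < τ)
    (h : IsCPSequence A B L γ τ lam z zb)
    (hA : SingleValuedContinuous (opResolvent (opScale γ A)))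
    (hB : SingleValuedContinuous (opResolvent (opScale τ (opInv B)))) :
    ∃ F : Rnm n m → Rnm n m, Continuous F ∧ ∀ k, zb k = F (precond L γ τ (z k)) := by
  obtain ⟨f, hf, hfA⟩ := hA
  obtain ⟨g, hg, hgB⟩ := hB
  have hfst : Continuous fun w : Rnm n m => w.fst :=
    (WithLp.prod_continuous_ofLp 2 (Rn n) (Rn m)).fst
  have hsnd : Continuous fun w : Rnm n m => w.snd :=
    (WithLp.prod_continuous_ofLp 2 (Rn n) (Rn m)).snd
  have hf' : Continuous fun w : Rnm n m => f (γ • w.fst) := hf.comp (hfst.const_smul γ)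
  refine ⟨fun w => WithLp.toLp 2 (f (γ • w.fst),
    g (τ • w.snd + (2 * τ) • L (f (γ • w.fst)))), ?_, fun k => ?_⟩
  · exact (WithLp.prod_continuous_toLp 2 (Rn n) (Rn m)).comp (hf'.prodMk
      (hg.comp ((hsnd.const_smul τ).add ((L.continuous.comp hf').const_smul (2 * τ)))))
  · obtain ⟨h1, h2, -, -⟩ := h k
    rw [hfA, Set.mem_singleton_iff] at h1
    rw [hgB, Set.mem_singleton_iff] at h2
    have e1 : γ • (precond L γ τ (z k)).fst = (z k).fst - γ • trL L (z k).snd := by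
      rw [precond_fst, smul_sub, one_div, smul_inv_smul₀ hγ.ne']
    have e2 : τ • (precond L γ τ (z k)).snd + (2 * τ) • L (zb k).fst
        = (z k).snd + τ • L ((2 : ℝ) • (zb k).fst - (z k).fst) := by
      rw [precond_snd, smul_add, one_div, smul_inv_smul₀ hτ.ne', map_sub, map_smul]
      module
    refine ext_fst_snd ?_ ?_
    · change (zb k).fst = f (γ • (precond L γ τ (z k)).fst)
      rw [e1, ← h1]
    · change (zb k).snd = g (τ • (precond L γ τ (z k)).snd
        + (2 * τ) • L (f (γ • (precond L γ τ (z k)).fst)))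
      rw [e1, ← h1, e2, ← h2]

end Algorithm

end ChambollePock

/-! ### The convergence theorem -/

theorem theorem3p4 {n m : ℕ}
    (A : Rn n → Set (Rn n)) (B : Rn m → Set (Rn m)) (L : Rn n →L[ℝ] Rn m) (hL : L ≠ 0)
    (hA : OuterSemicontinuous A) (hB : OuterSemicontinuous B)
    (γ τ : ℝ) (hγ : 0 < γ) (hτ : 0 < τ)
    (hJA : dom (opResolvent (opScale γ A)) = Set.univ)
    (hJB : dom (opResolvent (opScale τ (opInv B))) = Set.univ)
    (βP βP' βD βD' : ℝ) (S : Set (Rnm n m))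
    (hS : HasObliqueWeakMinty (TPD A B L) (Vmap L βP βP' βD βD') S)
    (hβ : ExistenceConditions L βP βP' βD βD')
    (hstep : StepsizeRule L βP βP' βD βD' γ τ)
    (lam : ℕ → ℝ) (hlam : RelaxationRule L βP βP' βD βD' γ τ lam)
    (z zb : ℕ → Rnm n m) (hz : IsCPSequence A B L γ τ lam z zb) :
    ((∃ k, zb k ∈ zer (TPD A B L)) ∨
      ((∀ k, precond L γ τ (z k - zb k) ∈ TPD A B L (zb k)) ∧
        Tendsto (fun k => precond L γ τ (z k - zb k)) atTop (𝓝 0) ∧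
        (∀ p, MapClusterPt p atTop zb → p ∈ zer (TPD A B L)) ∧
        Bornology.IsBounded (Set.range fun k => projRangeP L γ τ (z k)) ∧
        Bornology.IsBounded (Set.range fun k => projRangeP L γ τ (zb k)))) ∧
    (SingleValuedContinuous (opResolvent (opScale γ A)) →
      SingleValuedContinuous (opResolvent (opScale τ (opInv B))) →
      (∀ p, MapClusterPt p atTop (fun k => projRangeP L γ τ (z k)) →
        p ∈ projRangeP L γ τ '' zer (TPD A B L)) ∧
      (S = zer (TPD A B L) →
        (∃ p ∈ projRangeP L γ τ '' zer (TPD A B L),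
          Tendsto (fun k => projRangeP L γ τ (z k)) atTop (𝓝 p)) ∧
        (∃ q ∈ zer (TPD A B L), Tendsto zb atTop (𝓝 q)) ∧
        ((∃ ε > 0, ∀ k, ε ≤ lam k ∧ lam k ≤ 2 - ε) →
          ∃ q ∈ zer (TPD A B L), Tendsto z atTop (𝓝 q)))) := by
  have hL2 : 0 < ‖L‖ ^ 2 := by
    have := norm_pos_iff.2 hL
    positivity
  have hle : γ * τ ≤ 1 / ‖L‖ ^ 2 := by
    have h := hstep.tau_upper
    rw [le_div_iff₀ (by positivity)] at h
    rw [le_div_iff₀ hL2]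
    linarith
  have hle' : ‖L‖ ^ 2 ≤ 1 / (γ * τ) := by
    rwa [le_div_iff₀ (by positivity), mul_comm, ← le_div_iff₀ hL2]
  have hM := isSymmetric_precond L γ τ
  have hnn := inner_precond_self_nonneg L hγ hτ hle'
  have hC := norm_precond_sq_le L hγ hτ hle'
  have hC0 : 0 ≤ 1 / γ + 1 / τ := by positivity
  have hsucc := hz.succ_eq
  have hmem := hz.precond_mem hγ hτ
  have hfejer : ∀ q ∈ S, ∀ k, etaBar L βP βP' βD βD' γ τ *
      inner ℝ (precond L γ τ (z k - zb k)) (z k - zb k)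
        ≤ inner ℝ (precond L γ τ (z k - zb k)) (z k - q) := by
    intro q hq k
    have h1 := etaBar_mul_inner_le L hL (βP := βP) (βP' := βP') (βD := βD) (βD' := βD') hγ hτ hle
      (z k - zb k)
    have h2 := hS.2.2 q hq (zb k) _ (hmem k)
    rw [← sub_add_sub_cancel (z k) (zb k) q, inner_add_right]
    linarith
  obtain ⟨q₀, hq₀⟩ := hS.1
  have hres : Tendsto (fun k => precond L γ τ (z k - zb k)) atTop (𝓝 0) :=
    tendsto_residual hM hnn hC hlam.mem hlam.liminf_pos hsucc (hfejer q₀ hq₀)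
  have hzer : ∀ (φ : ℕ → ℕ) (q : Rnm n m), StrictMono φ →
      Tendsto (fun k => zb (φ k)) atTop (𝓝 q) → q ∈ zer (TPD A B L) := fun φ q hφ hq =>
    mem_zer_TPD_of_tendsto hA hB (fun k => hmem (φ k)) hq (hres.comp hφ.tendsto_atTop)
  obtain ⟨G, hG, hGM⟩ := exists_projRangeP_eq_comp L γ τ
  have hbdd := isBounded_range_map_iterate hM hnn hC0 hC hlam.mem hsucc (hfejer q₀ hq₀)
  have hbddz : Bornology.IsBounded (Set.range fun k => projRangeP L γ τ (z k)) := by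
    have h := (hbdd.isCompact_closure.image hG).isBounded
    refine h.subset ?_
    rintro _ ⟨k, rfl⟩
    exact ⟨_, subset_closure ⟨k, rfl⟩, (hGM _).symm⟩
  have hPres : Tendsto (fun k => projRangeP L γ τ (z k) - projRangeP L γ τ (zb k)) atTop
      (𝓝 0) := by
    have h0 : G 0 = 0 := by
      have h := hGM 0
      rw [map_zero] at h
      rw [← h]
      exact map_zero (LinearMap.range (precond L γ τ)).starProjection
    have h1 := (hG.tendsto 0).comp hres
    rw [h0] at h1
    exact h1.congr fun k => by rw [← projRangeP_sub, hGM]; rfl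
  have hbddzb : Bornology.IsBounded (Set.range fun k => projRangeP L γ τ (zb k)) := by
    have h := hbddz.sub (Metric.isBounded_range_of_tendsto _ hPres)
    refine h.subset ?_
    rintro _ ⟨k, rfl⟩
    exact ⟨_, ⟨k, rfl⟩, _, ⟨k, rfl⟩, sub_sub_cancel _ _⟩
  -- The second alternative holds whether or not some `zb k` is a zero.
  refine ⟨Or.inr ⟨hmem, hres, fun p hp => ?_, hbddz, hbddzb⟩, fun hfA hfB => ?_⟩
  · obtain ⟨φ, hφ, hlim⟩ := hp.tendsto_subseq
    exact hzer φ p hφ hlim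
  obtain ⟨F, hF, hzbF⟩ := hz.exists_eq_comp_precond hγ hτ hfA hfB
  -- Since `M` ignores the projection, `M (z (φ k)) → M p` and so `zb (φ k) → F (M p)`, a zero. It
  -- projects to `p` because the projected residual vanishes.
  have hcluster : ∀ (φ : ℕ → ℕ) (p : Rnm n m), StrictMono φ →
      Tendsto (fun k => projRangeP L γ τ (z (φ k))) atTop (𝓝 p) →
      Tendsto (fun k => precond L γ τ (z (φ k))) atTop (𝓝 (precond L γ τ p)) ∧
        F (precond L γ τ p) ∈ zer (TPD A B L) ∧
        projRangeP L γ τ (F (precond L γ τ p)) = p := by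
    intro φ p hφ hp
    have h1 : Tendsto (fun k => precond L γ τ (z (φ k))) atTop (𝓝 (precond L γ τ p)) :=
      (((continuous_precond L γ τ).tendsto p).comp hp).congr fun k => precond_projRangeP L γ τ _
    have h2 : Tendsto (fun k => zb (φ k)) atTop (𝓝 (F (precond L γ τ p))) :=
      ((hF.tendsto _).comp h1).congr fun k => (hzbF (φ k)).symm
    refine ⟨h1, hzer φ _ hφ h2, ?_⟩
    have h3 := ((continuous_projRangeP L γ τ).tendsto _).comp h2
    have h4 := hp.sub (hPres.comp hφ.tendsto_atTop)
    rw [sub_zero] at h4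
    exact tendsto_nhds_unique h3 (h4.congr fun k => sub_sub_cancel _ _)
  refine ⟨fun p hp => ?_, fun hSzer => ?_⟩
  · obtain ⟨φ, hφ, hlim⟩ := hp.tendsto_subseq
    obtain ⟨-, h1, h2⟩ := hcluster φ p hφ hlim
    exact ⟨_, h1, h2⟩
  have hprop : ProperSpace (Rnm n m) := FiniteDimensional.proper_real _
  obtain ⟨p, -, φ, hφ, hlim⟩ := tendsto_subseq_of_bounded hbddz fun k => Set.mem_range_self k
  obtain ⟨h1, h2, h3⟩ := hcluster φ p hφ hlim
  set q := F (precond L γ τ p) with hq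
  have hMq : precond L γ τ p = precond L γ τ q := by rw [← h3, precond_projRangeP]
  -- Fejér monotonicity is needed at the limit `q` itself, which is available because every zero
  -- belongs to `S`.
  have hMz : Tendsto (fun k => precond L γ τ (z k)) atTop (𝓝 (precond L γ τ q)) :=
    tendsto_map_iterate_of_subseq hM hnn hC hlam.mem hsucc (hfejer q (hSzer ▸ h2)) hφ (hMq ▸ h1)
  have hzbq : Tendsto zb atTop (𝓝 q) := by
    have h := (hF.tendsto _).comp hMz
    rw [← hMq, ← hq] at h
    exact h.congr fun k => (hzbF k).symm
  refine ⟨⟨_, ⟨q, h2, rfl⟩, ?_⟩, ⟨q, h2, hzbq⟩, fun ⟨ε, hε, hlamε⟩ => ⟨q, h2, ?_⟩⟩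
  · rw [hGM q]
    exact ((hG.tendsto _).comp hMz).congr fun k => (hGM _).symm
  · exact tendsto_of_relaxation hε hlamε hsucc hzbq
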